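/- **Setting.** Terms are built over a signature of function symbols and a set of variables; a substitution moves finitely many variables. Let $\succ$ be a Knuth--Bendix order (for a total precedence $\gg$ and a weight function $w$ into $\mathbb N$), a lexicographic path order (for a total precedence $\gg$), or another simplification ordering. Here $|t|$ is the weight of $t$, the linear expression $\sum_f |t|_f w(f)+\sum_x |t|_x\,x$, and $\sigma(\alpha_0+\sum\alpha_i x_i)=\alpha_0+\sum\alpha_i|x_i\sigma|$; $\sigma$ is grounding for $e$ if $\sigma(e)$ is a constant and every $|x\sigma|$ that is a constant is at least the smallest weight of a constant symbol; $e>0$ (resp. $e\gtrsim0$) means $\sigma(e)>0$ (resp. $\ge0$) for all $\sigma$ grounding for $e$. The KBO is defined by: $s\succ t$ iff (K1) $|s|-|t|>0$; or $|s|-|t|\gtrsim0$, $s=f(\bar s)$, $t=g(\bar t)$ and (K2) $f\gg g$, or (K3) $f=g$ and for some $i$, $s_j=t_j$ for $j<i$ and $s_i\succ t_i$. The LPO is the usual one. **TODs.** A term ordering diagram (TOD) is a finite acyclic directed multigraph with one root (one unlabelled outgoing edge), from which every node is reachable; one exit node, without outgoing edges and reachable from every node; and further nodes of three kinds: term comparison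 nodes $s\,?\,t$ with outgoing edges labelled $>,=,\ngeq$; positivity check nodes $e\,?\,0$ ($e$ a linear expression; only for KBO) with outgoing edges labelled $>,\ge,\ngeq$; and success nodes, labelled by an equality $l\simeq r$, with one unlabelled outgoing edge. The first two kinds are the evaluation nodes. Put $\sigma(s\,?\,t)={>}$ if $s\sigma\succ t\sigma$, ${=}$ if $s\sigma=t\sigma$, and $\ngeq$ otherwise; $\sigma(e\,?\,0)={>}$ if $\sigma(e)>0$, otherwise $\ge$ if $\sigma(e)\gtrsim0$, and otherwise $\ngeq$. A $\sigma$-path is a path that leaves each evaluation node labelled $c$ on it along the edge labelled $\sigma(c)$. The traversal for $\sigma$ is the $\sigma$-path from the root to the exit; the success set of $\sigma$ is the set of labels of the success nodes on it. Two TODs are equivalent if every $\sigma$ has the same success set in both. An evaluation node $n$ labelled $c$ forces $\ell$ if $\sigma(c)=\ell$ for every $\sigma$ whose traversal contains $n$. **Transformations.** After (a) and (c), non-root nodes without incoming edges are removed repeatedly. (a) *Redundant node removal*: if $n$ forces $\ell$, an edge into $n$ is redirected to the target of the $\ell$-edge of $n$. (b) *Node replication*: if the non-exit node $n$ has several incoming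 edges, one of them is redirected to a new node that is an exact copy of $n$ with the same outgoing edges. (c) *KBO/LPO transformations* of a node $n$ labelled $f(s_1,\dots,s_k)\,?\,g(t_1,\dots,t_m)$ whose $>,=,\ngeq$ edges lead to $n_1,n_2,n_3$. Write $[c;a,b,d]$ for a node labelled $c$ whose three edges lead, in order, to $a,b,d$; all other nodes named are new. Below $s=f(\bar s)$, $t=g(\bar t)$. KBO: $n$ becomes $[|s|-|t|\,?\,0;\,n_1,x,n_3]$ with $x=n_1$ if $f\gg g$; $x=n_3$ if $g\gg f$; and, if $f=g$, $x=p_1$ with $p_i=[s_i\,?\,t_i;\,n_1,p_{i+1},n_3]$ for $1\le i\le k$ and $p_{k+1}=n_2$. LPO: $n$ is replaced by $p_1$, where: if $f\gg g$, $p_i=[s\,?\,t_i;\,p_{i+1},n_3,n_3]$ for $1\le i\le m$, $p_{m+1}=n_1$; if $g\gg f$, $p_i=[s_i\,?\,t;\,n_1,n_1,p_{i+1}]$ for $1\le i\le k$, $p_{k+1}=n_3$; if $f=g$, $p_i=[s_i\,?\,t_i;\,a_{i+1},p_{i+1},b_{i+1}]$ for $1\le i\le k$, $p_{k+1}=n_2$,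 and $a_i=[s\,?\,t_i;\,a_{i+1},n_3,n_3]$, $b_i=[s_i\,?\,t;\,n_1,n_1,b_{i+1}]$ for $2\le i\le k$, $a_{k+1}=n_1$, $b_{k+1}=n_3$. **Retrieval.** A forcing function is a partial function $F$ from paths of TODs to edge labels such that for every $\sigma$ and every $\sigma$-path from the root consisting of a path $\pi$ and one further edge, if $F(\pi)=\ell$ then that edge is labelled $\ell$. An index is a TOD in which some nodes are marked visited. A retrieval for $\sigma$ starts at the successor of the root and repeats the following steps, $n$ being the current node and $\pi$ the path followed from the root to $n$. 1. If $n$ is the exit node, stop. 2. If $n$ is a success node, one may stop (when only one candidate is wanted); if $n$ is a visited success node, one may go to its successor. 3. If $n$ is an unvisited evaluation or success node: if $n$ has more than one incoming edge, replicate it, redirecting the edge just followed to the copy, which becomes the current node. Once there is only one incoming edge: (3a) if $n$ is an evaluation node and $F(\pi)=\ell$, redirect this edge to the target of the $\ell$-edge of $n$ (which becomes the current node) and remove nodes without incoming edges as above; (3b) if a KBO transformation (for $\succ$ a KBO) or an LPO transformation (for $\succ$ an LPO) applies to $n$, apply it, the node replacing $n$ becoming the current node; (3c) otherwise mark $n$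 visited. 4. If $n$ is a visited evaluation node labelled $c$, follow its edge labelled $\sigma(c)$. **Lemma (Correctness).** Let $F$ be a forcing function, and let an index be given that arises from a TOD without visited nodes by a finite sequence of retrievals and insertions (an insertion of $l\simeq r$ redirects all edges to the exit node to a new node $l\,?\,r$ whose $>$ edge leads to a new success node $l\simeq r$ and whose other edges, as well as the edge of that success node, lead to the exit node). Let $\mathcal D$ be its TOD and $\sigma$ a substitution. Then the diagram $\mathcal D'$ resulting from a retrieval for $\sigma$ is a TOD equivalent to $\mathcal D$. Moreover, at every point of the retrieval the current diagram is a TOD equivalent to $\mathcal D$; every visited node has exactly one path from the root; every step (3a) is a genuine redundant node removal, i.e. $n$ forces $\ell$; and every step leaves the TOD unchanged or is an instance of one of the transformations (a)--(c). -/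

import Mathlib

open FirstOrder.Language

universe u v w

namespace TOD

/-! ## Terms, substitutions, linear expressions

Terms are Mathlib's first-order terms `L.Term V` over the function symbols of `L`
and the variables `V`; the relation symbols of `L` play no role. -/

section Terms

variable {L : FirstOrder.Language.{u, v}} {V : Type w}

/-- The function symbols of the signature. -/
abbrev Symb (L : FirstOrder.Language.{u, v}) : Type u := Σ n, L.Functions n

/-- A substitution: a map from variables to terms moving only finitely many variables. -/
structure Subst (L : FirstOrder.Language.{u, v}) (V : Type w) where
  toFun : V → L.Term V
  finite_moved : {x | toFun x ≠ Term.var x}.Finite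

/-- `σ.app t` is the term `tσ`. -/
def Subst.app (σ : Subst L V) (t : L.Term V) : L.Term V := t.subst σ.toFun

/-- `ImmediateSubterm t s`: `t` is an argument of `s`. -/
inductive ImmediateSubterm : L.Term V → L.Term V → Prop
  | mk {k : ℕ} (f : L.Functions k) (ss : Fin k → L.Term V) (i : Fin k) :
      ImmediateSubterm (ss i) (Term.func f ss)

/-- `ProperSubterm t s`: `t` is a proper subterm of `s`. -/
def ProperSubterm : L.Term V → L.Term V → Prop := Relation.TransGen ImmediateSubterm

/-- Simplification orderings; `gt s t` is `s ≻ t`. -/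
structure IsSimplificationOrdering (gt : L.Term V → L.Term V → Prop) : Prop where
  irrefl : ∀ s, ¬ gt s s
  trans : ∀ s t u, gt s t → gt t u → gt s u
  wellFounded : WellFounded fun s t => gt t s
  stable : ∀ (σ : Subst L V) s t, gt s t → gt (σ.app s) (σ.app t)
  monotone : ∀ {k : ℕ} (f : L.Functions k) (ss : Fin k → L.Term V) (i : Fin k) s t, gt s t →
    gt (Term.func f (Function.update ss i s)) (Term.func f (Function.update ss i t))
  subterm : ∀ s t, ProperSubterm t s → gt s t

/-- Linear expressions `α₀ + ∑ αₓ · x` with integer coefficients: the constant part and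
the (finitely supported) coefficients. -/
abbrev LinExpr (V : Type w) : Type w := ℤ × (V →₀ ℤ)

/-- The weight `|t|` of a term: the sum of the weights of the occurrences of function symbols
plus the sum of the occurrences of variables. -/
noncomputable def weight (wt : Symb L → ℕ) : L.Term V → LinExpr V
  | .var x => (0, Finsupp.single x 1)
  | .func f ts => ((wt ⟨_, f⟩ : ℤ), 0) + ∑ i, weight wt (ts i)

/-- `σ(α₀ + ∑ αₓ · x) = α₀ + ∑ αₓ · |xσ|`. -/
noncomputable def Subst.appLin (wt : Symb L → ℕ) (σ : Subst L V) (e : LinExpr V) : LinExpr V :=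
  (e.1, 0) + e.2.sum fun x a => a • weight wt (σ.toFun x)

/-- The smallest weight of a constant. -/
noncomputable def minConstWeight (wt : Symb L → ℕ) : ℕ :=
  sInf {a | ∃ c : L.Functions 0, a = wt ⟨0, c⟩}

/-- `σ` is grounding for `e`. -/
def Grounding (wt : Symb L → ℕ) (σ : Subst L V) (e : LinExpr V) : Prop :=
  (σ.appLin wt e).2 = 0 ∧
    ∀ x, (weight wt (σ.toFun x)).2 = 0 →
      (minConstWeight wt : ℤ) ≤ (weight wt (σ.toFun x)).1

/-- `e > 0`: positive under every grounding substitution. -/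
def LinPos (wt : Symb L → ℕ) (e : LinExpr V) : Prop :=
  ∀ σ : Subst L V, Grounding wt σ e → 0 < (σ.appLin wt e).1

/-- `e ≳ 0`: nonnegative under every grounding substitution. -/
def LinNonneg (wt : Symb L → ℕ) (e : LinExpr V) : Prop :=
  ∀ σ : Subst L V, Grounding wt σ e → 0 ≤ (σ.appLin wt e).1

/-- The Knuth-Bendix order with precedence `prec` (`prec f g` is `f ≫ g`) and weights `wt`. -/
inductive KBO (prec : Symb L → Symb L → Prop) (wt : Symb L → ℕ) :
    L.Term V → L.Term V → Prop
  | weight_gt {s t : L.Term V} : LinPos wt (weight wt s - weight wt t) → KBO prec wt s t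
  | prec {k m : ℕ} {f : L.Functions k} {g : L.Functions m}
      {ss : Fin k → L.Term V} {ts : Fin m → L.Term V} :
      LinNonneg wt (weight wt (Term.func f ss) - weight wt (Term.func g ts)) →
      prec ⟨k, f⟩ ⟨m, g⟩ →
      KBO prec wt (Term.func f ss) (Term.func g ts)
  | lex {k : ℕ} {f : L.Functions k} {ss ts : Fin k → L.Term V} (i : Fin k) :
      LinNonneg wt (weight wt (Term.func f ss) - weight wt (Term.func f ts)) →
      KBO prec wt (ss i) (ts i) → (∀ j, j < i → ss j = ts j) →
      KBO prec wt (Term.func f ss) (Term.func f ts)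

/-- The lexicographic path order with precedence `prec`. -/
inductive LPO (prec : Symb L → Symb L → Prop) : L.Term V → L.Term V → Prop
  | lex {k : ℕ} {f : L.Functions k} {ss ts : Fin k → L.Term V} (i : Fin k) :
      (∀ j, j < i → ss j = ts j) → LPO prec (ss i) (ts i) →
      (∀ j, i < j → LPO prec (Term.func f ss) (ts j)) →
      LPO prec (Term.func f ss) (Term.func f ts)
  | prec {k m : ℕ} {f : L.Functions k} {g : L.Functions m}
      {ss : Fin k → L.Term V} {ts : Fin m → L.Term V} :
      prec ⟨k, f⟩ ⟨m, g⟩ → (∀ j, LPO prec (Term.func f ss) (ts j)) →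
      LPO prec (Term.func f ss) (Term.func g ts)
  | arg_gt {k : ℕ} {f : L.Functions k} {ss : Fin k → L.Term V} {t : L.Term V} (i : Fin k) :
      LPO prec (ss i) t → LPO prec (Term.func f ss) t
  | arg_eq {k : ℕ} {f : L.Functions k} {ss : Fin k → L.Term V} (i : Fin k) :
      LPO prec (Term.func f ss) (ss i)

/-- The term ordering used: a KBO, an LPO, or some other simplification ordering
(for which only the ordering-independent transformations are available).
A precedence is a (strict) total order on the function symbols. -/
inductive TermOrdering (L : FirstOrder.Language.{u, v}) (V : Type w) where
  | kbo (prec : Symb L → Symb L → Prop) (hprec : IsStrictTotalOrder (Symb L) prec)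
      (wt : Symb L → ℕ)
  | lpo (prec : Symb L → Symb L → Prop) (hprec : IsStrictTotalOrder (Symb L) prec)
  | other (gt : L.Term V → L.Term V → Prop) (hgt : IsSimplificationOrdering gt)

/-- The relation `≻`. -/
def TermOrdering.gt : TermOrdering L V → L.Term V → L.Term V → Prop
  | .kbo prec _ wt => KBO prec wt
  | .lpo prec _ => LPO prec
  | .other gt _ => gt

/-- The ordering is a KBO. -/
def TermOrdering.IsKBO : TermOrdering L V → Prop
  | .kbo _ _ _ => True
  | _ => False

end Terms

/-! ## Term ordering diagrams -/

/-- The edge labels `>`, `=`, `≥` and `≱`. -/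
inductive EdgeLabel
  | gt | eq | geq | ngeq
  deriving DecidableEq

/-- What a node carries: root, exit, a term comparison `s ? t`, a positivity check `e ? 0`,
or (success node) an equality `l ≃ r`. -/
inductive NodeLabel (L : FirstOrder.Language.{u, v}) (V : Type w)
  | root
  | exit
  | cmp (s t : L.Term V)
  | pos (e : LinExpr V)
  | success (l r : L.Term V)

section Diagrams

variable {L : FirstOrder.Language.{u, v}} {V : Type w}

open Classical in
/-- The value `σ(s ? t)`. -/
noncomputable def TermOrdering.evalCmp (ord : TermOrdering L V) (σ : Subst L V)
    (s t : L.Term V) : EdgeLabel :=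
  if ord.gt (σ.app s) (σ.app t) then .gt
  else if σ.app s = σ.app t then .eq
  else .ngeq

open Classical in
/-- The value `σ(e ? 0)`. Positivity checks only occur for KBO; the value for the
other orderings is irrelevant. -/
noncomputable def TermOrdering.evalPos (ord : TermOrdering L V) (σ : Subst L V)
    (e : LinExpr V) : EdgeLabel :=
  match ord with
  | .kbo _ _ wt =>
      if LinPos wt (σ.appLin wt e) then .gt
      else if LinNonneg wt (σ.appLin wt e) then .geq
      else .ngeq
  | _ => .ngeq

/-- The label of the edge along which `σ` leaves a node with the given label
(`none` at nodes that are not evaluation nodes: their outgoing edge is unlabelled). -/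
noncomputable def TermOrdering.eval (ord : TermOrdering L V) (σ : Subst L V) :
    NodeLabel L V → Option EdgeLabel
  | .cmp s t => some (ord.evalCmp σ s t)
  | .pos e => some (ord.evalPos σ e)
  | _ => none

/-- Evaluation nodes: term comparison nodes and positivity check nodes. -/
def NodeLabel.IsEval : NodeLabel L V → Prop
  | .cmp _ _ => True
  | .pos _ => True
  | _ => False

/-- Success nodes. -/
def NodeLabel.IsSuccess : NodeLabel L V → Prop
  | .success _ _ => True
  | _ => False

/-- The outgoing edges that a node with the given label has (`none`: an unlabelled edge). -/
def NodeLabel.out : NodeLabel L V → Set (Option EdgeLabel)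
  | .root => {none}
  | .exit => ∅
  | .cmp _ _ => {some .gt, some .eq, some .ngeq}
  | .pos _ => {some .gt, some .geq, some .ngeq}
  | .success _ _ => {none}

/-- A finite rooted labelled multigraph with node names in `ℕ`. The values of `label` outside of
`nodes`, and the values of `next` where there is no edge, are irrelevant. -/
structure Diagram (L : FirstOrder.Language.{u, v}) (V : Type w) where
  nodes : Finset ℕ
  root : ℕ
  exit : ℕ
  label : ℕ → NodeLabel L V
  next : ℕ → Option EdgeLabel → ℕ

namespace Diagram

/-- There is an edge from `m` to `n` with label `ℓ`. -/
def Edge (D : Diagram L V) (m : ℕ) (ℓ : Option EdgeLabel) (n : ℕ) : Prop :=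
  m ∈ D.nodes ∧ ℓ ∈ (D.label m).out ∧ D.next m ℓ = n

/-- There is an edge from `m` to `n`. -/
def Adj (D : Diagram L V) (m n : ℕ) : Prop := ∃ ℓ, D.Edge m ℓ n

/-- The incoming edges of `n`, as pairs of a source and an edge label. -/
def inEdges (D : Diagram L V) (n : ℕ) : Set (ℕ × Option EdgeLabel) :=
  {p | D.Edge p.1 p.2 n}

/-- Term ordering diagrams. -/
structure IsTOD (ord : TermOrdering L V) (D : Diagram L V) : Prop where
  root_mem : D.root ∈ D.nodes
  exit_mem : D.exit ∈ D.nodes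
  label_root : ∀ n ∈ D.nodes, (D.label n = .root ↔ n = D.root)
  label_exit : ∀ n ∈ D.nodes, (D.label n = .exit ↔ n = D.exit)
  target_mem : ∀ m ℓ n, D.Edge m ℓ n → n ∈ D.nodes
  acyclic : ∀ n, ¬ Relation.TransGen D.Adj n n
  reachable_root : ∀ n ∈ D.nodes, Relation.ReflTransGen D.Adj D.root n
  reaches_exit : ∀ n ∈ D.nodes, Relation.ReflTransGen D.Adj n D.exit
  pos_kbo : ∀ n ∈ D.nodes, ∀ e, D.label n = .pos e → ord.IsKBO

/-- A path is given by its sequence of edges, each edge by its source and its label: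
`D.IsPath a π b` says that `π` is a path from `a` to `b`. -/
inductive IsPath (D : Diagram L V) : ℕ → List (ℕ × Option EdgeLabel) → ℕ → Prop
  | nil {a : ℕ} : a ∈ D.nodes → IsPath D a [] a
  | cons {a c b : ℕ} {ℓ : Option EdgeLabel} {π : List (ℕ × Option EdgeLabel)} :
      D.Edge a ℓ c → IsPath D c π b → IsPath D a ((a, ℓ) :: π) b

/-- Every edge of `π` that leaves an evaluation node is the one chosen by `σ`. -/
def IsSubstPath (ord : TermOrdering L V) (D : Diagram L V) (σ : Subst L V)
    (π : List (ℕ × Option EdgeLabel)) : Prop :=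
  ∀ p ∈ π, (D.label p.1).IsEval → p.2 = ord.eval σ (D.label p.1)

/-- `π` is the traversal of `D` for `σ`. (In a TOD there is exactly one such `π`.) -/
def IsTraversal (ord : TermOrdering L V) (D : Diagram L V) (σ : Subst L V)
    (π : List (ℕ × Option EdgeLabel)) : Prop :=
  D.IsPath D.root π D.exit ∧ D.IsSubstPath ord σ π

/-- The success set of `σ` in `D`: the labels of the success nodes on the traversal. -/
def successSet (ord : TermOrdering L V) (D : Diagram L V) (σ : Subst L V) :
    Set (L.Term V × L.Term V) :=
  {q | ∃ π, D.IsTraversal ord σ π ∧ ∃ p ∈ π, D.label p.1 = .success q.1 q.2}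

/-- Equivalence of TODs. -/
def Equivalent (ord : TermOrdering L V) (D₁ D₂ : Diagram L V) : Prop :=
  ∀ σ : Subst L V, D₁.successSet ord σ = D₂.successSet ord σ

/-- The evaluation node `n` forces the edge label `ℓ`. -/
def Forces (ord : TermOrdering L V) (D : Diagram L V) (n : ℕ) (ℓ : EdgeLabel) : Prop :=
  (D.label n).IsEval ∧
    ∀ (σ : Subst L V) (π : List (ℕ × Option EdgeLabel)), D.IsTraversal ord σ π →
      (∃ p ∈ π, p.1 = n) → ord.eval σ (D.label n) = some ℓ

/-! ## Transformations -/

/-- Remove a node other than the root that has no incoming edge. -/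
def RemoveOrphan (D D' : Diagram L V) : Prop :=
  ∃ n ∈ D.nodes, n ≠ D.root ∧ D.inEdges n = ∅ ∧ D' = { D with nodes := D.nodes.erase n }

/-- Repeatedly remove nodes without incoming edges (other than the root) until there are none. -/
def Cleanup (D D' : Diagram L V) : Prop :=
  Relation.ReflTransGen RemoveOrphan D D' ∧
    ∀ n ∈ D'.nodes, n ≠ D'.root → (D'.inEdges n).Nonempty

/-- Let the edge of `m` labelled `ℓ` point to `n`. -/
def redirect (D : Diagram L V) (m : ℕ) (ℓ : Option EdgeLabel) (n : ℕ) : Diagram L V :=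
  { D with next := fun a b => if a = m ∧ b = ℓ then n else D.next a b }

/-- Let all edges to `n` point to `n'` instead. -/
def replaceNode (D : Diagram L V) (n n' : ℕ) : Diagram L V :=
  { D with next := fun a b => if D.next a b = n then n' else D.next a b }

/-- Bypass: the edge from `m` to `n` labelled `ℓ'` is redirected to the target of the edge of the
evaluation node `n` labelled `ℓ`, namely `n₂`; then nodes without incoming edges are removed. -/
def Bypass (D : Diagram L V) (m : ℕ) (ℓ' : Option EdgeLabel) (n : ℕ) (ℓ : EdgeLabel) (n₂ : ℕ)
    (D' : Diagram L V) : Prop :=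
  D.Edge m ℓ' n ∧ (D.label n).IsEval ∧ D.Edge n (some ℓ) n₂ ∧ Cleanup (D.redirect m ℓ' n₂) D'

/-- Redundant node removal: a bypass of a node along a label that this node forces. -/
def RedundantNodeRemoval (ord : TermOrdering L V) (D : Diagram L V) (m : ℕ)
    (ℓ' : Option EdgeLabel) (n : ℕ) (ℓ : EdgeLabel) (n₂ : ℕ) (D' : Diagram L V) : Prop :=
  D.Forces ord n ℓ ∧ D.Bypass m ℓ' n ℓ n₂ D'

/-- Node replication: the non-exit node `n` has several incoming edges; the one from `m` with label
`ℓ` is redirected to an exact copy `n₂` of `n`, a new node with the same label and the same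
outgoing edges. -/
def NodeReplication (D : Diagram L V) (m : ℕ) (ℓ : Option EdgeLabel) (n n₂ : ℕ)
    (D' : Diagram L V) : Prop :=
  D.Edge m ℓ n ∧ n ≠ D.exit ∧ (D.inEdges n).Nontrivial ∧ n₂ ∉ D.nodes ∧
    D' = { D with
      nodes := insert n₂ D.nodes
      label := fun a => if a = n₂ then D.label n else D.label a
      next := fun a b =>
        if a = m ∧ b = ℓ then n₂ else if a = n₂ then D.next n b else D.next a b }

/-- `n` is a term comparison node `s ? t` with `>`, `=`, `≱` edges to `a`, `b`, `c`. -/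
def IsCmp (D : Diagram L V) (n : ℕ) (s t : L.Term V) (a b c : ℕ) : Prop :=
  n ∈ D.nodes ∧ D.label n = .cmp s t ∧
    D.next n (some .gt) = a ∧ D.next n (some .eq) = b ∧ D.next n (some .ngeq) = c

/-- `n` is a positivity check node `e ? 0` with `>`, `≥`, `≱` edges to `a`, `b`, `c`. -/
def IsPos (D : Diagram L V) (n : ℕ) (e : LinExpr V) (a b c : ℕ) : Prop :=
  n ∈ D.nodes ∧ D.label n = .pos e ∧
    D.next n (some .gt) = a ∧ D.next n (some .geq) = b ∧ D.next n (some .ngeq) = c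

/-- `D'` has the nodes of `D` and the pairwise distinct new nodes `ν i`, and agrees with `D`
at all nodes of `D` except `n`. -/
structure Extends {ι : Type} (D : Diagram L V) (n : ℕ) (ν : ι → ℕ) (D' : Diagram L V) : Prop where
  injective : Function.Injective ν
  fresh : ∀ i, ν i ∉ D.nodes
  root_eq : D'.root = D.root
  exit_eq : D'.exit = D.exit
  nodes_eq : ∀ m, m ∈ D'.nodes ↔ m ∈ D.nodes ∨ ∃ i, ν i = m
  label_eq : ∀ m ∈ D.nodes, m ≠ n → D'.label m = D.label m
  next_eq : ∀ m ∈ D.nodes, m ≠ n → D'.next m = D.next m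

/-- `ν j`, or `d` if `j` is beyond the end of the sequence `ν`. -/
def nodeAt {k : ℕ} (ν : Fin k → ℕ) (d : ℕ) (j : ℕ) : ℕ :=
  if h : j < k then ν ⟨j, h⟩ else d

/-- The KBO transformations of a node `n` labelled `f(s₁,…,s_k) ? g(t₁,…,t_m)`
with `>`, `=`, `≱` edges to `n₁`, `n₂`, `n₃` (before removal of nodes without incoming edges). -/
inductive KBOReplace (prec : Symb L → Symb L → Prop) (wt : Symb L → ℕ)
    (D : Diagram L V) (n : ℕ) (D' : Diagram L V) : Prop
  | greater {k m : ℕ} {f : L.Functions k} {g : L.Functions m}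
      {ss : Fin k → L.Term V} {ts : Fin m → L.Term V} {n₁ n₂ n₃ : ℕ} :
      D.IsCmp n (Term.func f ss) (Term.func g ts) n₁ n₂ n₃ →
      prec ⟨k, f⟩ ⟨m, g⟩ →
      D.Extends n (Fin.elim0 : Fin 0 → ℕ) D' →
      D'.IsPos n (weight wt (Term.func f ss) - weight wt (Term.func g ts)) n₁ n₁ n₃ →
      KBOReplace prec wt D n D'
  | less {k m : ℕ} {f : L.Functions k} {g : L.Functions m}
      {ss : Fin k → L.Term V} {ts : Fin m → L.Term V} {n₁ n₂ n₃ : ℕ} :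
      D.IsCmp n (Term.func f ss) (Term.func g ts) n₁ n₂ n₃ →
      prec ⟨m, g⟩ ⟨k, f⟩ →
      D.Extends n (Fin.elim0 : Fin 0 → ℕ) D' →
      D'.IsPos n (weight wt (Term.func f ss) - weight wt (Term.func g ts)) n₁ n₃ n₃ →
      KBOReplace prec wt D n D'
  | same {k : ℕ} {f : L.Functions k} {ss ts : Fin k → L.Term V} {n₁ n₂ n₃ : ℕ}
      (ν : Fin k → ℕ) :
      D.IsCmp n (Term.func f ss) (Term.func f ts) n₁ n₂ n₃ →
      D.Extends n ν D' →
      D'.IsPos n (weight wt (Term.func f ss) - weight wt (Term.func f ts))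
        n₁ (nodeAt ν n₂ 0) n₃ →
      (∀ i : Fin k, D'.IsCmp (ν i) (ss i) (ts i) n₁ (nodeAt ν n₂ (i + 1)) n₃) →
      KBOReplace prec wt D n D'

/-- The LPO transformations of a node `n` labelled `f(s₁,…,s_k) ? g(t₁,…,t_m)`
with `>`, `=`, `≱` edges to `n₁`, `n₂`, `n₃` (before removal of nodes without incoming edges);
`top` is the node that takes the place of `n`. In the cases with new nodes, `n` itself is
the first node of the new subgraph. -/
inductive LPOReplace (prec : Symb L → Symb L → Prop)
    (D : Diagram L V) (n : ℕ) (D' : Diagram L V) : (top : ℕ) → Prop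
  | greater_const {k : ℕ} {f : L.Functions k} {g : L.Functions 0}
      {ss : Fin k → L.Term V} {ts : Fin 0 → L.Term V} {n₁ n₂ n₃ : ℕ} :
      D.IsCmp n (Term.func f ss) (Term.func g ts) n₁ n₂ n₃ →
      prec ⟨k, f⟩ ⟨0, g⟩ →
      D' = D.replaceNode n n₁ →
      LPOReplace prec D n D' n₁
  | greater {k m : ℕ} {f : L.Functions k} {g : L.Functions (m + 1)}
      {ss : Fin k → L.Term V} {ts : Fin (m + 1) → L.Term V} {n₁ n₂ n₃ : ℕ}
      (ν : Fin m → ℕ) :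
      D.IsCmp n (Term.func f ss) (Term.func g ts) n₁ n₂ n₃ →
      prec ⟨k, f⟩ ⟨m + 1, g⟩ →
      D.Extends n ν D' →
      (∀ i : Fin (m + 1), D'.IsCmp ((Fin.cons n ν : Fin (m + 1) → ℕ) i)
        (Term.func f ss) (ts i) (nodeAt ν n₁ i) n₃ n₃) →
      LPOReplace prec D n D' n
  | less_const {m : ℕ} {f : L.Functions 0} {g : L.Functions m}
      {ss : Fin 0 → L.Term V} {ts : Fin m → L.Term V} {n₁ n₂ n₃ : ℕ} :
      D.IsCmp n (Term.func f ss) (Term.func g ts) n₁ n₂ n₃ →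
      prec ⟨m, g⟩ ⟨0, f⟩ →
      D' = D.replaceNode n n₃ →
      LPOReplace prec D n D' n₃
  | less {k m : ℕ} {f : L.Functions (k + 1)} {g : L.Functions m}
      {ss : Fin (k + 1) → L.Term V} {ts : Fin m → L.Term V} {n₁ n₂ n₃ : ℕ}
      (ν : Fin k → ℕ) :
      D.IsCmp n (Term.func f ss) (Term.func g ts) n₁ n₂ n₃ →
      prec ⟨m, g⟩ ⟨k + 1, f⟩ →
      D.Extends n ν D' →
      (∀ i : Fin (k + 1), D'.IsCmp ((Fin.cons n ν : Fin (k + 1) → ℕ) i)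
        (ss i) (Term.func g ts) n₁ n₁ (nodeAt ν n₃ i)) →
      LPOReplace prec D n D' n
  | same_const {f : L.Functions 0} {ss ts : Fin 0 → L.Term V} {n₁ n₂ n₃ : ℕ} :
      D.IsCmp n (Term.func f ss) (Term.func f ts) n₁ n₂ n₃ →
      D' = D.replaceNode n n₂ →
      LPOReplace prec D n D' n₂
  /- The new nodes of the left, middle and right column are `left i`, `mid i`, `right i`, where
  the index `i` (from `0`) stands for argument position `i + 2`;
  `n` is the middle node for position `1`. -/
  | same {k : ℕ} {f : L.Functions (k + 1)} {ss ts : Fin (k + 1) → L.Term V} {n₁ n₂ n₃ : ℕ}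
      (left mid right : Fin k → ℕ) :
      D.IsCmp n (Term.func f ss) (Term.func f ts) n₁ n₂ n₃ →
      D.Extends n (Sum.elim left (Sum.elim mid right)) D' →
      (∀ i : Fin (k + 1), D'.IsCmp ((Fin.cons n mid : Fin (k + 1) → ℕ) i)
        (ss i) (ts i) (nodeAt left n₁ i) (nodeAt mid n₂ i) (nodeAt right n₃ i)) →
      (∀ i : Fin k, D'.IsCmp (left i) (Term.func f ss) (ts i.succ)
        (nodeAt left n₁ (i + 1)) n₃ n₃) →
      (∀ i : Fin k, D'.IsCmp (right i) (ss i.succ) (Term.func f ts)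
        n₁ n₁ (nodeAt right n₃ (i + 1))) →
      LPOReplace prec D n D' n

/-- The ordering-specific transformations at `n`: the KBO transformations if the ordering is a KBO,
the LPO transformations if it is an LPO, and none otherwise; followed by the removal of nodes
without incoming edges. The node `top` takes the place of `n`. -/
def SpecificTransformation (ord : TermOrdering L V) (D : Diagram L V) (n : ℕ)
    (D' : Diagram L V) (top : ℕ) : Prop :=
  match ord with
  | .kbo prec _ wt => ∃ D₁, KBOReplace prec wt D n D₁ ∧ Cleanup D₁ D' ∧ top = n
  | .lpo prec _ => ∃ D₁, LPOReplace prec D n D₁ top ∧ Cleanup D₁ D'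
  | .other _ _ => False

/-- The TOD transformations. -/
inductive Transformation (ord : TermOrdering L V) (D D' : Diagram L V) : Prop
  | redundant (m : ℕ) (ℓ' : Option EdgeLabel) (n : ℕ) (ℓ : EdgeLabel) (n₂ : ℕ) :
      D.RedundantNodeRemoval ord m ℓ' n ℓ n₂ D' → Transformation ord D D'
  | replication (m : ℕ) (ℓ : Option EdgeLabel) (n n₂ : ℕ) :
      D.NodeReplication m ℓ n n₂ D' → Transformation ord D D'
  | specific (n top : ℕ) :
      D.SpecificTransformation ord n D' top → Transformation ord D D'

end Diagram

/-! ## Retrieval -/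

/-- `F` is a forcing function: a partial function from paths (of TODs) to edge labels such that,
whenever `F` is defined on a path from the root, every extension of this path
by an edge that is a `σ`-path for some `σ` ends with an edge labelled by the value of `F`.
`F D π n` is the value on the path `π` of `D` from the root to `n`. -/
def IsForcingFunction (ord : TermOrdering L V)
    (F : Diagram L V → List (ℕ × Option EdgeLabel) → ℕ → Option EdgeLabel) : Prop :=
  ∀ D : Diagram L V, D.IsTOD ord → ∀ (σ : Subst L V) (π : List (ℕ × Option EdgeLabel)) (n n' : ℕ)
    (ℓ' : Option EdgeLabel) (ℓ : EdgeLabel),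
    D.IsPath D.root π n → D.Edge n ℓ' n' → D.IsSubstPath ord σ (π ++ [(n, ℓ')]) →
    F D π n = some ℓ → ℓ' = some ℓ

/-- The index: a diagram and its set of visited nodes. -/
structure Index (L : FirstOrder.Language.{u, v}) (V : Type w) where
  diag : Diagram L V
  visited : Finset ℕ

/-- The state of a running retrieval: the index, the path followed, and the current node. -/
structure Config (L : FirstOrder.Language.{u, v}) (V : Type w) extends Index L V where
  path : List (ℕ × Option EdgeLabel)
  node : ℕ

/-- The traversal starts in the successor of the root node. -/
def Index.start (I : Index L V) : Config L V :=
  { I with path := [(I.diag.root, none)], node := I.diag.next I.diag.root none }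

namespace Config

/-- The configuration `c` after changing the diagram to `D'` and the current node to `n'`
(nodes that have been removed are no longer visited). -/
def change (c : Config L V) (D' : Diagram L V) (n' : ℕ) : Config L V :=
  { diag := D', visited := c.visited.filter (· ∈ D'.nodes), path := c.path, node := n' }

/-- The current node is an unvisited evaluation or success node. -/
def Unvisited (c : Config L V) : Prop :=
  c.node ∉ c.visited ∧ ((c.diag.label c.node).IsEval ∨ (c.diag.label c.node).IsSuccess)

/-- Follow the only edge of a visited success node. -/
def StepSuccess (c c' : Config L V) : Prop :=
  c.node ∈ c.visited ∧ (c.diag.label c.node).IsSuccess ∧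
    c' = { c with path := c.path ++ [(c.node, none)], node := c.diag.next c.node none }

/-- Follow the edge of a visited evaluation node that is chosen by `σ`. -/
def StepFollow (ord : TermOrdering L V) (σ : Subst L V) (c c' : Config L V) : Prop :=
  c.node ∈ c.visited ∧ (c.diag.label c.node).IsEval ∧
    c' = { c with
      path := c.path ++ [(c.node, ord.eval σ (c.diag.label c.node))]
      node := c.diag.next c.node (ord.eval σ (c.diag.label c.node)) }

/-- An unvisited node with more than one incoming edge is replicated,
and the traversal continues with the copy, whose only incoming edge is the one just followed. -/
def StepReplicate (c c' : Config L V) : Prop :=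
  c.Unvisited ∧ (c.diag.inEdges c.node).Nontrivial ∧
    ∃ (π : List (ℕ × Option EdgeLabel)) (m : ℕ) (ℓ : Option EdgeLabel) (n₂ : ℕ) (D' : Diagram L V),
      c.path = π ++ [(m, ℓ)] ∧ c.diag.NodeReplication m ℓ c.node n₂ D' ∧ c' = c.change D' n₂

/-- If `F` gives the label `ℓ`, an unvisited evaluation node with a single incoming edge
is bypassed along its `ℓ` edge. (That it forces `ℓ` is not required here.) -/
def StepRemove (F : Diagram L V → List (ℕ × Option EdgeLabel) → ℕ → Option EdgeLabel)
    (c c' : Config L V) : Prop :=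
  c.Unvisited ∧ (c.diag.inEdges c.node).Subsingleton ∧
    ∃ (π : List (ℕ × Option EdgeLabel)) (m : ℕ) (ℓ' : Option EdgeLabel) (ℓ : EdgeLabel) (n₂ : ℕ)
      (D' : Diagram L V),
      c.path = π ++ [(m, ℓ')] ∧ F c.diag c.path c.node = some ℓ ∧
      c.diag.Bypass m ℓ' c.node ℓ n₂ D' ∧ c' = c.change D' n₂

/-- A KBO or LPO transformation is applied to an unvisited node with a single incoming edge. -/
def StepTransform (ord : TermOrdering L V) (c c' : Config L V) : Prop :=
  c.Unvisited ∧ (c.diag.inEdges c.node).Subsingleton ∧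
    ∃ (D' : Diagram L V) (top : ℕ),
      c.diag.SpecificTransformation ord c.node D' top ∧ c' = c.change D' top

/-- An unvisited node with a single incoming edge to which neither of the previous two steps
is applicable is marked visited. -/
def StepMark (ord : TermOrdering L V)
    (F : Diagram L V → List (ℕ × Option EdgeLabel) → ℕ → Option EdgeLabel)
    (c c' : Config L V) : Prop :=
  c.Unvisited ∧ (c.diag.inEdges c.node).Subsingleton ∧
    F c.diag c.path c.node = none ∧
    (¬ ∃ D' top, c.diag.SpecificTransformation ord c.node D' top) ∧
    c' = { c with visited := insert c.node c.visited }

/-- One step of the retrieval algorithm for the query substitution `σ`. -/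
inductive Step (ord : TermOrdering L V)
    (F : Diagram L V → List (ℕ × Option EdgeLabel) → ℕ → Option EdgeLabel)
    (σ : Subst L V) (c c' : Config L V) : Prop
  | success : StepSuccess c c' → Step ord F σ c c'
  | replicate : StepReplicate c c' → Step ord F σ c c'
  | remove : StepRemove F c c' → Step ord F σ c c'
  | transform : StepTransform ord c c' → Step ord F σ c c'
  | mark : StepMark ord F c c' → Step ord F σ c c'
  | follow : StepFollow ord σ c c' → Step ord F σ c c'

/-- The retrieval may stop in `c`: at the exit node, or (if only one candidate is wanted)
at a success node. -/
def Final (c : Config L V) : Prop :=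
  c.node = c.diag.exit ∨ (c.diag.label c.node).IsSuccess

end Config

namespace Index

/-- The configuration `c` occurs in a retrieval from `I` for `σ`. -/
def Reaches (ord : TermOrdering L V)
    (F : Diagram L V → List (ℕ × Option EdgeLabel) → ℕ → Option EdgeLabel)
    (σ : Subst L V) (I : Index L V) (c : Config L V) : Prop :=
  Relation.ReflTransGen (Config.Step ord F σ) I.start c

/-- A retrieval from `I` for `σ` ends with the index `I'`. -/
def Retrieval (ord : TermOrdering L V)
    (F : Diagram L V → List (ℕ × Option EdgeLabel) → ℕ → Option EdgeLabel)
    (σ : Subst L V) (I I' : Index L V) : Prop :=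
  ∃ c, Reaches ord F σ I c ∧ c.Final ∧ c.toIndex = I'

/-- Insertion of the equality `l ≃ r`: a new comparison node `a` labelled `l ? r` is put just
before the exit node; its `>` edge leads to a new success node `b`, and its other edges
and the edge of `b` lead to the exit node. -/
def Insertion (l r : L.Term V) (I I' : Index L V) : Prop :=
  ∃ a b : ℕ, a ∉ I.diag.nodes ∧ b ∉ I.diag.nodes ∧ a ≠ b ∧
    I' =
      { diag :=
          { I.diag with
            nodes := insert a (insert b I.diag.nodes)
            label := fun x =>
              if x = a then .cmp l r else if x = b then .success l r else I.diag.label x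
            next := fun x y =>
              if x = a then (if y = some .gt then b else I.diag.exit)
              else if x = b then I.diag.exit
              else if I.diag.next x y = I.diag.exit then a
              else I.diag.next x y }
        visited := I.visited }

/-- The indexes that arise from a TOD without visited nodes by insertions and retrievals.
(Deleting an equality does not change the index.) -/
inductive Arises (ord : TermOrdering L V)
    (F : Diagram L V → List (ℕ × Option EdgeLabel) → ℕ → Option EdgeLabel) : Index L V → Prop
  | init (D : Diagram L V) : D.IsTOD ord → Arises ord F { diag := D, visited := ∅ }
  | insertion {I I' : Index L V} (l r : L.Term V) :
      Arises ord F I → Insertion l r I I' → Arises ord F I'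
  | retrieval {I I' : Index L V} (σ : Subst L V) :
      Arises ord F I → Retrieval ord F σ I I' → Arises ord F I'

end Index

end Diagrams

end TOD

/-!
Assign to a node `a` and a substitution `σ` the labels of the success nodes that `σ` visits from `a`
on. They are determined by recursion along the steps of `σ`, so that a transformation preserves all
success sets as soon as, for every `σ`, it replaces a step at the changed node by steps through
evaluation nodes with the same destination; for the KBO and LPO transformations this is the
recursive definition of the ordering. Nodes without incoming edges are on no path from the root, and
in a finite acyclic diagram in which every node but the root has an incoming edge all nodes are
reachable from the root.

During a retrieval, every visited node has a single incoming edge, which comes from a visited node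
or from the root, so the visited nodes form a tree. As a transformation is applied at an unvisited
node only, it does not touch this tree. Hence a node that has a single incoming edge and is reached
through visited nodes has a single path from the root, all traversals through it begin with that
path, and the label given by the forcing function is forced.
-/

namespace TOD

section Orderings

variable {L : FirstOrder.Language.{u, v}} {V : Type w} {wt : Symb L → ℕ}

theorem Subst.appLin_sub (σ : Subst L V) (e e' : LinExpr V) :
    σ.appLin wt (e - e') = σ.appLin wt e - σ.appLin wt e' := by
  have coeff_part : (e - e').2.sum (fun x a => a • weight wt (σ.toFun x)) =
      e.2.sum (fun x a => a • weight wt (σ.toFun x)) -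
        e'.2.sum (fun x a => a • weight wt (σ.toFun x)) :=
    Finsupp.sum_sub_index fun x a b => sub_smul a b _
  have const_part : (((e - e').1, 0) : LinExpr V) = (e.1, 0) - (e'.1, 0) := by simp
  rw [appLin, appLin, appLin, coeff_part, const_part]
  abel

theorem Subst.weight_app (σ : Subst L V) (t : L.Term V) :
    weight wt (σ.app t) = σ.appLin wt (weight wt t) := by
  induction t with
  | var x =>
    have app_var : σ.app (Term.var x) = σ.toFun x := rfl
    simp [app_var, weight, appLin, Finsupp.sum_single_index, ← Prod.zero_eq_mk]
  | @func k f ts ih =>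
    let appHom : LinExpr V →+ LinExpr V := .ofMapSub (σ.appLin wt) σ.appLin_sub
    calc weight wt (σ.app (Term.func f ts))
        = ((wt ⟨k, f⟩ : ℤ), 0) + ∑ i, weight wt (σ.app (ts i)) := rfl
      _ = appHom ((wt ⟨k, f⟩ : ℤ), 0) + ∑ i, appHom (weight wt (ts i)) := by
          rw [Finset.sum_congr rfl fun i _ => ih i]
          simp [appHom, appLin]
      _ = appHom (weight wt (Term.func f ts)) := by rw [weight, map_add, map_sum]

theorem LinPos.linNonneg {e : LinExpr V} (h : LinPos wt e) : LinNonneg wt e :=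
  fun σ hσ => (h σ hσ).le

theorem linNonneg_zero : LinNonneg wt (0 : LinExpr V) :=
  fun σ _ => by simp [Subst.appLin]

section Precedence

variable {prec : Symb L → Symb L → Prop} {k m : ℕ} {f : L.Functions k} {g : L.Functions m}
  {ss ss' : Fin k → L.Term V} {ts : Fin m → L.Term V}

theorem func_ne_func_of_prec [Std.Irrefl prec] (hfg : prec ⟨k, f⟩ ⟨m, g⟩) :
    Term.func f ss ≠ Term.func g ts := by
  rintro ⟨⟩
  exact irrefl _ hfg

theorem KBO.func_iff_of_prec (hfg : prec ⟨k, f⟩ ⟨m, g⟩) :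
    KBO prec wt (Term.func f ss) (Term.func g ts) ↔
      LinNonneg wt (weight wt (Term.func f ss) - weight wt (Term.func g ts)) := by
  refine ⟨fun h => ?_, fun h => .prec h hfg⟩
  cases h with
  | weight_gt h => exact h.linNonneg
  | prec h _ => exact h
  | lex _ h _ _ => exact h

theorem KBO.func_iff_of_prec_swap [Std.Asymm prec] (hgf : prec ⟨m, g⟩ ⟨k, f⟩) :
    KBO prec wt (Term.func f ss) (Term.func g ts) ↔
      LinPos wt (weight wt (Term.func f ss) - weight wt (Term.func g ts)) := by
  refine ⟨fun h => ?_, .weight_gt⟩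
  cases h with
  | weight_gt h => exact h
  | prec _ hfg => exact absurd hfg (asymm hgf)
  | lex _ _ _ _ => exact absurd hgf (irrefl _)

theorem KBO.func_iff_of_same [Std.Irrefl prec] :
    KBO prec wt (Term.func f ss) (Term.func f ss') ↔
      LinPos wt (weight wt (Term.func f ss) - weight wt (Term.func f ss')) ∨
        LinNonneg wt (weight wt (Term.func f ss) - weight wt (Term.func f ss')) ∧
          ∃ i, KBO prec wt (ss i) (ss' i) ∧ ∀ j < i, ss j = ss' j := by
  constructor
  · intro h
    cases h with
    | weight_gt h => exact .inl h
    | prec _ hff => exact absurd hff (irrefl _)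
    | lex i h hi hlt => exact .inr ⟨h, i, hi, hlt⟩
  · rintro (h | ⟨h, i, hi, hlt⟩)
    · exact .weight_gt h
    · exact .lex i h hi hlt

theorem LPO.of_arg_ge {t : L.Term V} {i : Fin k} (h : LPO prec (ss i) t ∨ ss i = t) :
    LPO prec (Term.func f ss) t := by
  rcases h with h | rfl
  · exact .arg_gt i h
  · exact .arg_eq i

theorem LPO.gt_arg {s : L.Term V} (h : LPO prec s (Term.func g ts)) (j : Fin m) :
    LPO prec s (ts j) := by
  generalize ht : Term.func g ts = t at h
  induction h with
  | lex i heq hi hgt _ _ =>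
    cases ht
    rcases lt_trichotomy j i with hji | rfl | hij
    · exact heq j hji ▸ .arg_eq j
    · exact .arg_gt j hi
    · exact hgt j hij
  | prec _ h _ => cases ht; exact h j
  | arg_gt i _ ih => exact .arg_gt i (ih ht)
  | arg_eq i => exact .arg_gt i (ht ▸ .arg_eq j)

theorem LPO.gt_arg_of_ge {s : L.Term V} (h : LPO prec s (Term.func g ts) ∨ s = Term.func g ts)
    (j : Fin m) : LPO prec s (ts j) := by
  rcases h with h | rfl
  · exact h.gt_arg j
  · exact .arg_eq j

theorem LPO.func_iff_of_prec (hfg : prec ⟨k, f⟩ ⟨m, g⟩) :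
    LPO prec (Term.func f ss) (Term.func g ts) ↔ ∀ j, LPO prec (Term.func f ss) (ts j) :=
  ⟨LPO.gt_arg, .prec hfg⟩

theorem LPO.func_iff_of_prec_swap [Std.Asymm prec] (hgf : prec ⟨m, g⟩ ⟨k, f⟩) :
    LPO prec (Term.func f ss) (Term.func g ts) ↔
      ∃ i, LPO prec (ss i) (Term.func g ts) ∨ ss i = Term.func g ts := by
  refine ⟨fun h => ?_, fun ⟨_, hi⟩ => of_arg_ge hi⟩
  generalize ht : Term.func g ts = t at h ⊢
  cases h with
  | lex _ _ _ _ => cases ht; exact absurd hgf (irrefl _)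
  | prec hfg _ => cases ht; exact absurd hfg (asymm hgf)
  | arg_gt i h => exact ⟨i, .inl h⟩
  | arg_eq i => exact ⟨i, .inr rfl⟩

theorem LPO.func_iff_of_first_gt {i : Fin k} (heq : ∀ j < i, ss j = ss' j)
    (hi : LPO prec (ss i) (ss' i)) :
    LPO prec (Term.func f ss) (Term.func f ss') ↔ ∀ j > i, LPO prec (Term.func f ss) (ss' j) :=
  ⟨fun h j _ => h.gt_arg j, .lex i heq hi⟩

theorem LPO.exists_of_func_same [Std.Irrefl prec]
    (h : LPO prec (Term.func f ss) (Term.func f ss')) :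
    (∃ i, (∀ j < i, ss j = ss' j) ∧ LPO prec (ss i) (ss' i)) ∨
      ∃ i, LPO prec (ss i) (Term.func f ss') ∨ ss i = Term.func f ss' := by
  generalize ht : Term.func f ss' = t at h ⊢
  cases h with
  | lex i heq hi _ => cases ht; exact .inl ⟨i, heq, hi⟩
  | prec hff _ => cases ht; exact absurd hff (irrefl _)
  | arg_gt i h => exact .inr ⟨i, .inl h⟩
  | arg_eq i => exact .inr ⟨i, .inr rfl⟩

theorem LPO.func_iff_of_first_not_ge [Std.Irrefl prec] {i : Fin k}
    (heq : ∀ j < i, ¬ LPO prec (ss j) (ss' j) ∧ ss j = ss' j)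
    (hi : ¬ LPO prec (ss i) (ss' i)) (hne : ss i ≠ ss' i) :
    LPO prec (Term.func f ss) (Term.func f ss') ↔
      ∃ j > i, LPO prec (ss j) (Term.func f ss') ∨ ss j = Term.func f ss' := by
  have not_gt : ∀ j ≤ i, ¬ LPO prec (ss j) (ss' j) := fun j hj =>
    hj.lt_or_eq.elim (fun h => (heq j h).1) fun h => h ▸ hi
  refine ⟨fun h => ?_, fun ⟨_, _, hj⟩ => of_arg_ge hj⟩
  obtain ⟨j, hlt, hj⟩ | ⟨j, hj⟩ := h.exists_of_func_same
  · have hij : i < j := lt_of_not_ge fun hji => not_gt j hji hj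
    exact absurd (hlt i hij) hne
  · exact ⟨j, lt_of_not_ge fun hji => not_gt j hji (gt_arg_of_ge hj j), hj⟩

theorem LPO.not_func_self [Std.Irrefl prec] (h : ∀ j, ¬ LPO prec (ss j) (ss j)) :
    ¬ LPO prec (Term.func f ss) (Term.func f ss) := by
  intro hf
  obtain ⟨j, _, hj⟩ | ⟨j, hj⟩ := hf.exists_of_func_same
  · exact h j hj
  · exact h j (gt_arg_of_ge hj j)

end Precedence

section Evaluation

variable {ord : TermOrdering L V} {σ : Subst L V} {s t : L.Term V}

theorem evalCmp_eq_gt : ord.evalCmp σ s t = .gt ↔ ord.gt (σ.app s) (σ.app t) := by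
  unfold TermOrdering.evalCmp
  split_ifs <;> simp_all

theorem evalCmp_eq_eq :
    ord.evalCmp σ s t = .eq ↔ ¬ ord.gt (σ.app s) (σ.app t) ∧ σ.app s = σ.app t := by
  unfold TermOrdering.evalCmp
  split_ifs <;> simp_all

theorem evalCmp_eq_ngeq :
    ord.evalCmp σ s t = .ngeq ↔ ¬ ord.gt (σ.app s) (σ.app t) ∧ σ.app s ≠ σ.app t := by
  unfold TermOrdering.evalCmp
  split_ifs <;> simp_all

theorem NodeLabel.eval_mem_out {c : NodeLabel L V} (hc : c ≠ .exit) : ord.eval σ c ∈ c.out := by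
  cases c with
  | root => rfl
  | exit => exact absurd rfl hc
  | cmp s t =>
    simp only [TermOrdering.eval, TermOrdering.evalCmp]
    split_ifs <;> simp [out]
  | pos e =>
    cases ord <;> simp only [TermOrdering.eval, TermOrdering.evalPos]
    · split_ifs <;> simp [out]
    all_goals simp [out]
  | success l r => rfl

theorem NodeLabel.eq_eval_of_mem_out {c : NodeLabel L V} {ℓ : Option EdgeLabel} (hout : ℓ ∈ c.out)
    (heval : c.IsEval → ℓ = ord.eval σ c) : ℓ = ord.eval σ c := by
  cases c with
  | root => exact hout
  | exit => exact absurd hout (Set.notMem_empty _)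
  | cmp s t => exact heval trivial
  | pos e => exact heval trivial
  | success l r => exact hout

variable {prec : Symb L → Symb L → Prop} {hprec : IsStrictTotalOrder (Symb L) prec}

theorem evalPos_weight_sub_eq_gt :
    (TermOrdering.kbo prec hprec wt).evalPos σ (weight wt s - weight wt t) = .gt ↔
      LinPos wt (weight wt (σ.app s) - weight wt (σ.app t)) := by
  rw [σ.weight_app, σ.weight_app, ← σ.appLin_sub]
  simp only [TermOrdering.evalPos]
  split_ifs <;> simp_all

theorem evalPos_weight_sub_eq_geq :
    (TermOrdering.kbo prec hprec wt).evalPos σ (weight wt s - weight wt t) = .geq ↔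
      ¬ LinPos wt (weight wt (σ.app s) - weight wt (σ.app t)) ∧
        LinNonneg wt (weight wt (σ.app s) - weight wt (σ.app t)) := by
  rw [σ.weight_app, σ.weight_app, ← σ.appLin_sub]
  simp only [TermOrdering.evalPos]
  split_ifs <;> simp_all

theorem evalPos_weight_sub_eq_ngeq :
    (TermOrdering.kbo prec hprec wt).evalPos σ (weight wt s - weight wt t) = .ngeq ↔
      ¬ LinNonneg wt (weight wt (σ.app s) - weight wt (σ.app t)) := by
  rw [σ.weight_app, σ.weight_app, ← σ.appLin_sub]
  simp only [TermOrdering.evalPos]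
  split_ifs with hpos hnonneg
  · simpa using hpos.linNonneg
  · simpa using hnonneg
  · simpa using hnonneg

end Evaluation

/-- The labels admitted at nodes other than the root and the exit: comparisons, successes and, for
a KBO only, positivity checks. -/
def NodeLabel.IsInner (ord : TermOrdering L V) (c : NodeLabel L V) : Prop :=
  c ≠ .root ∧ c ≠ .exit ∧ ∀ e, c = .pos e → ord.IsKBO

/-- The identity substitution, used where any substitution would do. -/
def Subst.id (L : FirstOrder.Language.{u, v}) (V : Type w) : Subst L V :=
  ⟨Term.var, by simp⟩

end Orderings

namespace Diagram

section PreTOD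

variable {L : FirstOrder.Language.{u, v}} {V : Type w} {ord : TermOrdering L V}
  {D D' : Diagram L V}

/-- Diagrams that are TODs up to nodes that are not reachable from the root. These are closed under
the local transformations before the removal of nodes without incoming edges; that the exit is a
node and can be reached from everywhere follows from finiteness and acyclicity. -/
structure IsPreTOD (ord : TermOrdering L V) (D : Diagram L V) : Prop where
  root_mem : D.root ∈ D.nodes
  label_root : D.label D.root = .root
  label_exit : D.label D.exit = .exit
  isInner_label : ∀ n ∈ D.nodes, n ≠ D.root → n ≠ D.exit → (D.label n).IsInner ord
  target : ∀ m ℓ n, D.Edge m ℓ n → n ∈ D.nodes ∧ n ≠ D.root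
  acyclic : ∀ n, ¬ Relation.TransGen D.Adj n n

theorem acyclic_of_rank {α : Type*} [Preorder α] (r : ℕ → α)
    (hr : ∀ a b, D.Adj a b → r b < r a) (n : ℕ) : ¬ Relation.TransGen D.Adj n n := by
  intro hn
  have hlt : Relation.TransGen (fun x y : α => x > y) (r n) (r n) := hn.lift r hr
  rw [Relation.transGen_eq_self] at hlt
  exact lt_irrefl _ hlt

namespace IsPreTOD

open Classical in
theorem exists_rank (h : D.IsPreTOD ord) : ∃ r : ℕ → ℕ, ∀ a b, D.Adj a b → r b < r a := by
  refine ⟨fun a => (D.nodes.filter (Relation.TransGen D.Adj a ·)).card, fun a b hab => ?_⟩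
  refine Finset.card_lt_card <| Finset.ssubset_iff_of_subset (fun x hx => ?_) |>.2 ⟨b, ?_, ?_⟩
  · rw [Finset.mem_filter] at hx ⊢
    exact ⟨hx.1, hx.2.head hab⟩
  · obtain ⟨ℓ, hℓ⟩ := hab
    exact Finset.mem_filter.2 ⟨(h.target _ _ _ hℓ).1, .single ⟨ℓ, hℓ⟩⟩
  · exact fun hb => h.acyclic b (Finset.mem_filter.1 hb).2

theorem label_eq_root_iff (h : D.IsPreTOD ord) {n : ℕ} (hn : n ∈ D.nodes) :
    D.label n = .root ↔ n = D.root := by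
  refine ⟨fun hl => by_contra fun hr => ?_, fun hr => hr ▸ h.label_root⟩
  by_cases hx : n = D.exit
  · rw [hx, h.label_exit] at hl
    cases hl
  · exact (h.isInner_label n hn hr hx).1 hl

theorem label_eq_exit_iff (h : D.IsPreTOD ord) {n : ℕ} (hn : n ∈ D.nodes) :
    D.label n = .exit ↔ n = D.exit := by
  refine ⟨fun hl => by_contra fun hx => ?_, fun hx => hx ▸ h.label_exit⟩
  by_cases hr : n = D.root
  · rw [hr, h.label_root] at hl
    cases hl
  · exact (h.isInner_label n hn hr hx).2.1 hl

theorem isKBO_of_label_eq_pos (h : D.IsPreTOD ord) {n : ℕ} (hn : n ∈ D.nodes) {e : LinExpr V}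
    (hl : D.label n = .pos e) : ord.IsKBO := by
  refine (h.isInner_label n hn (fun hr => ?_) fun hx => ?_).2.2 e hl
  · rw [hr, h.label_root] at hl
    cases hl
  · rw [hx, h.label_exit] at hl
    cases hl

theorem ne_root_of_isEval_or_isSuccess (h : D.IsPreTOD ord) {n : ℕ}
    (hn : (D.label n).IsEval ∨ (D.label n).IsSuccess) : n ≠ D.root := by
  rintro rfl
  rw [h.label_root] at hn
  exact hn.elim id id

theorem ne_exit_of_isEval_or_isSuccess (h : D.IsPreTOD ord) {n : ℕ}
    (hn : (D.label n).IsEval ∨ (D.label n).IsSuccess) : n ≠ D.exit := by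
  rintro rfl
  rw [h.label_exit] at hn
  exact hn.elim id id

theorem ne_exit_of_edge (h : D.IsPreTOD ord) {m n : ℕ} {ℓ : Option EdgeLabel}
    (he : D.Edge m ℓ n) : m ≠ D.exit := by
  rintro rfl
  have hout := he.2.1
  rw [h.label_exit] at hout
  exact hout

theorem ne_of_edge (h : D.IsPreTOD ord) {m n : ℕ} {ℓ : Option EdgeLabel}
    (he : D.Edge m ℓ n) : m ≠ n :=
  fun hmn => h.acyclic m (.single ⟨ℓ, hmn ▸ he⟩)

theorem edge_eval (h : D.IsPreTOD ord) (σ : Subst L V) {a : ℕ} (ha : a ∈ D.nodes)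
    (hx : a ≠ D.exit) :
    D.Edge a (ord.eval σ (D.label a)) (D.next a (ord.eval σ (D.label a))) :=
  ⟨ha, NodeLabel.eval_mem_out fun hl => hx ((h.label_eq_exit_iff ha).1 hl), rfl⟩

theorem root_ne_exit (h : D.IsPreTOD ord) : D.root ≠ D.exit := by
  intro heq
  have hl := h.label_exit
  rw [← heq, h.label_root] at hl
  cases hl

end IsPreTOD

/-- Every node other than the root has an incoming edge. For a pre-TOD this is what makes all nodes
reachable from the root. -/
def NoOrphan (D : Diagram L V) : Prop :=
  ∀ n ∈ D.nodes, n ≠ D.root → (D.inEdges n).Nonempty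

theorem IsTOD.isPreTOD (h : D.IsTOD ord) : D.IsPreTOD ord where
  root_mem := h.root_mem
  label_root := (h.label_root _ h.root_mem).2 rfl
  label_exit := (h.label_exit _ h.exit_mem).2 rfl
  isInner_label n hn hr hx :=
    ⟨fun hl => hr ((h.label_root n hn).1 hl), fun hl => hx ((h.label_exit n hn).1 hl),
      h.pos_kbo n hn⟩
  target m ℓ n he := by
    refine ⟨h.target_mem m ℓ n he, ?_⟩
    rintro rfl
    exact h.acyclic _ (.tail' (h.reachable_root m he.1) ⟨ℓ, he⟩)
  acyclic := h.acyclic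

theorem IsTOD.noOrphan (h : D.IsTOD ord) : D.NoOrphan := by
  intro n hn hr
  obtain rfl | ⟨m, -, ℓ, he⟩ := Relation.ReflTransGen.cases_tail (h.reachable_root n hn)
  · exact absurd rfl hr
  · exact ⟨(m, ℓ), he⟩

end PreTOD

section Steps

variable {L : FirstOrder.Language.{u, v}} {V : Type w} {ord : TermOrdering L V}
  {D D' : Diagram L V} {σ : Subst L V}

/-- `σ` leaves the node `a` along an edge to `b`. -/
def SubstStep (ord : TermOrdering L V) (D : Diagram L V) (σ : Subst L V) (a b : ℕ) : Prop :=
  a ∈ D.nodes ∧ a ≠ D.exit ∧ D.next a (ord.eval σ (D.label a)) = b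

/-- `σ` leaves the evaluation node `a` along an edge to `b`. -/
def EvalStep (ord : TermOrdering L V) (D : Diagram L V) (σ : Subst L V) (a b : ℕ) : Prop :=
  a ∈ D.nodes ∧ (D.label a).IsEval ∧ D.next a (ord.eval σ (D.label a)) = b

/-- The labels of the success nodes that `σ` visits from `a` on. The success set is the case of the
root; the point of the generalization is that a local transformation can be checked node by node. -/
def collect (ord : TermOrdering L V) (D : Diagram L V) (σ : Subst L V) (a : ℕ) :
    Set (L.Term V × L.Term V) :=
  {q | ∃ n ∈ D.nodes, Relation.ReflTransGen (D.SubstStep ord σ) a n ∧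
    D.label n = .success q.1 q.2}

theorem EvalStep.substStep (h : D.IsPreTOD ord) {a b : ℕ} (hab : D.EvalStep ord σ a b) :
    D.SubstStep ord σ a b :=
  ⟨hab.1, h.ne_exit_of_isEval_or_isSuccess (.inl hab.2.1), hab.2.2⟩

theorem SubstStep.edge (h : D.IsPreTOD ord) {a b : ℕ} (hab : D.SubstStep ord σ a b) :
    D.Edge a (ord.eval σ (D.label a)) b := by
  obtain ⟨ha, hx, rfl⟩ := hab
  exact h.edge_eval σ ha hx

theorem SubstStep.adj (h : D.IsPreTOD ord) {a b : ℕ} (hab : D.SubstStep ord σ a b) :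
    D.Adj a b :=
  ⟨_, hab.edge h⟩

theorem collect_of_substStep {a b : ℕ} (hab : D.SubstStep ord σ a b) :
    D.collect ord σ a = {q | D.label a = .success q.1 q.2} ∪ D.collect ord σ b := by
  ext q
  constructor
  · rintro ⟨n, hn, hr, hq⟩
    obtain rfl | ⟨c, hc, hr⟩ := Relation.ReflTransGen.cases_head hr
    · exact .inl hq
    · exact .inr ⟨n, hn, by rwa [← hab.2.2, hc.2.2], hq⟩
  · rintro (hq | ⟨n, hn, hr, hq⟩)
    · exact ⟨a, hab.1, .refl, hq⟩
    · exact ⟨n, hn, hr.head hab, hq⟩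

theorem setOf_label_eq_success_of_isEval {a : ℕ} (ha : (D.label a).IsEval) :
    {q : L.Term V × L.Term V | D.label a = .success q.1 q.2} = ∅ :=
  Set.eq_empty_of_forall_notMem fun q (hq : D.label a = _) => by rwa [hq] at ha

theorem collect_eq_of_evalStep (h : D.IsPreTOD ord) {a b : ℕ} (hab : D.EvalStep ord σ a b) :
    D.collect ord σ a = D.collect ord σ b := by
  rw [collect_of_substStep (hab.substStep h), setOf_label_eq_success_of_isEval hab.2.1,
    Set.empty_union]

theorem collect_eq_of_evalSteps (h : D.IsPreTOD ord) {a b : ℕ}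
    (hab : Relation.ReflTransGen (D.EvalStep ord σ) a b) :
    D.collect ord σ a = D.collect ord σ b := by
  induction hab with
  | refl => rfl
  | tail _ hbc ih => rw [ih, collect_eq_of_evalStep h hbc]

theorem collect_eq_of_next {a a' : ℕ} (ha : a ∈ D.nodes) (ha' : a' ∈ D'.nodes) (hx : a ≠ D.exit)
    (hx' : a' ≠ D'.exit) (hl : D'.label a' = D.label a)
    (h : D.collect ord σ (D.next a (ord.eval σ (D.label a))) =
      D'.collect ord σ (D'.next a' (ord.eval σ (D'.label a')))) :
    D.collect ord σ a = D'.collect ord σ a' := by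
  rw [collect_of_substStep ⟨ha, hx, rfl⟩, collect_of_substStep ⟨ha', hx', rfl⟩, h, hl]

theorem collect_exit (h : D.IsPreTOD ord) : D.collect ord σ D.exit = ∅ := by
  refine Set.eq_empty_of_forall_notMem ?_
  rintro q ⟨n, -, hr, hq⟩
  obtain rfl | ⟨c, hc, -⟩ := Relation.ReflTransGen.cases_head hr
  · rw [h.label_exit] at hq
    cases hq
  · exact hc.2.1 rfl

theorem IsPreTOD.reaches_exit (h : D.IsPreTOD ord) (σ : Subst L V) {a : ℕ} (ha : a ∈ D.nodes) :
    D.exit ∈ D.nodes ∧ Relation.ReflTransGen (D.SubstStep ord σ) a D.exit := by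
  obtain ⟨r, hr⟩ := h.exists_rank
  induction hk : r a using Nat.strong_induction_on generalizing a with
  | _ k ih =>
    by_cases hx : a = D.exit
    · exact ⟨hx ▸ ha, hx ▸ .refl⟩
    · have he := h.edge_eval σ ha hx
      obtain ⟨hmem, hsteps⟩ := ih _ (hk ▸ hr _ _ ⟨_, he⟩) (h.target _ _ _ he).1 rfl
      exact ⟨hmem, hsteps.head ⟨ha, hx, rfl⟩⟩

theorem IsPreTOD.exit_mem (h : D.IsPreTOD ord) : D.exit ∈ D.nodes :=
  (h.reaches_exit (Subst.id L V) h.root_mem).1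

theorem IsPreTOD.reachable_root (h : D.IsPreTOD ord) (ho : D.NoOrphan) {n : ℕ}
    (hn : n ∈ D.nodes) : Relation.ReflTransGen D.Adj D.root n := by
  classical
  obtain ⟨r, hr⟩ := h.exists_rank
  by_contra hreach
  obtain ⟨a, ha, hmax⟩ :=
    (D.nodes.filter (¬ Relation.ReflTransGen D.Adj D.root ·)).exists_max_image r
      ⟨n, Finset.mem_filter.2 ⟨hn, hreach⟩⟩
  rw [Finset.mem_filter] at ha
  obtain ⟨⟨m, ℓ⟩, he⟩ := ho a ha.1 fun hroot => ha.2 (hroot ▸ .refl)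
  have hm : ¬ Relation.ReflTransGen D.Adj D.root m := fun hm => ha.2 (hm.tail ⟨ℓ, he⟩)
  exact (hr m a ⟨ℓ, he⟩).not_ge (hmax m (Finset.mem_filter.2 ⟨he.1, hm⟩))

theorem IsPreTOD.isTOD (h : D.IsPreTOD ord) (ho : D.NoOrphan) : D.IsTOD ord where
  root_mem := h.root_mem
  exit_mem := h.exit_mem
  label_root _ := h.label_eq_root_iff
  label_exit _ := h.label_eq_exit_iff
  target_mem m ℓ n he := (h.target m ℓ n he).1
  acyclic := h.acyclic
  reachable_root _ := h.reachable_root ho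
  reaches_exit _ hn :=
    (h.reaches_exit (Subst.id L V) hn).2.lift id fun _ _ hab => hab.adj h
  pos_kbo _ hn _ := h.isKBO_of_label_eq_pos hn

end Steps

section Paths

variable {L : FirstOrder.Language.{u, v}} {V : Type w} {ord : TermOrdering L V}
  {D D' : Diagram L V} {σ : Subst L V}

theorem IsPath.append {a b c : ℕ} {π π' : List (ℕ × Option EdgeLabel)}
    (h : D.IsPath a π b) (h' : D.IsPath b π' c) : D.IsPath a (π ++ π') c := by
  induction h with
  | nil _ => exact h'
  | cons he _ ih => exact .cons he (ih h')

theorem isPath_append_iff {a c : ℕ} {π π' : List (ℕ × Option EdgeLabel)} :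
    D.IsPath a (π ++ π') c ↔ ∃ b, D.IsPath a π b ∧ D.IsPath b π' c := by
  refine ⟨fun h => ?_, fun ⟨b, h, h'⟩ => h.append h'⟩
  induction π generalizing a with
  | nil =>
    refine ⟨a, .nil ?_, h⟩
    cases h with
    | nil ha => exact ha
    | cons he _ => exact he.1
  | cons p π ih =>
    cases h with
    | cons he h =>
      obtain ⟨b, hb, hb'⟩ := ih h
      exact ⟨b, .cons he hb, hb'⟩

theorem IsPath.mem_right {a b : ℕ} {π : List (ℕ × Option EdgeLabel)} (h : D.IsPath a π b) :
    b ∈ D.nodes := by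
  induction h with
  | nil hb => exact hb
  | cons _ _ ih => exact ih

theorem isPath_nil_iff {a b : ℕ} : D.IsPath a [] b ↔ a = b ∧ a ∈ D.nodes := by
  constructor
  · rintro ⟨h⟩
    exact ⟨rfl, h⟩
  · rintro ⟨rfl, h⟩
    exact .nil h

theorem isPath_cons_iff {a b m : ℕ} {ℓ : Option EdgeLabel} {π : List (ℕ × Option EdgeLabel)} :
    D.IsPath a ((m, ℓ) :: π) b ↔ m = a ∧ ∃ c, D.Edge a ℓ c ∧ D.IsPath c π b := by
  constructor
  · rintro (_ | ⟨he, h⟩)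
    exact ⟨rfl, _, he, h⟩
  · rintro ⟨rfl, c, he, h⟩
    exact .cons he h

theorem IsPreTOD.isPath_concat_iff (h : D.IsPreTOD ord) {a b m : ℕ} {ℓ : Option EdgeLabel}
    {π : List (ℕ × Option EdgeLabel)} :
    D.IsPath a (π ++ [(m, ℓ)]) b ↔ D.IsPath a π m ∧ D.Edge m ℓ b := by
  rw [isPath_append_iff]
  constructor
  · rintro ⟨c, hc, hb⟩
    obtain ⟨rfl, d, he, hd⟩ := isPath_cons_iff.1 hb
    obtain ⟨rfl, -⟩ := isPath_nil_iff.1 hd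
    exact ⟨hc, he⟩
  · rintro ⟨hπ, he⟩
    exact ⟨m, hπ, .cons he (.nil (h.target _ _ _ he).1)⟩

theorem IsPreTOD.eq_nil_of_isPath_root (h : D.IsPreTOD ord) {a : ℕ}
    {π : List (ℕ × Option EdgeLabel)} (hπ : D.IsPath a π D.root) : π = [] := by
  obtain rfl | ⟨π, ⟨m, ℓ⟩, rfl⟩ := π.eq_nil_or_concat'
  · rfl
  · exact absurd rfl (h.target _ _ _ (h.isPath_concat_iff.1 hπ).2).2

theorem IsPath.exists_split {a b : ℕ} {π : List (ℕ × Option EdgeLabel)} (hπ : D.IsPath a π b)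
    {p : ℕ × Option EdgeLabel} (hp : p ∈ π) :
    ∃ π₁ π₂ c, π = π₁ ++ p :: π₂ ∧ D.IsPath a π₁ p.1 ∧ D.Edge p.1 p.2 c ∧ D.IsPath c π₂ b := by
  obtain ⟨π₁, π₂, rfl⟩ := List.append_of_mem hp
  obtain ⟨c, hc, hb⟩ := isPath_append_iff.1 hπ
  obtain ⟨rfl, d, he, hd⟩ := isPath_cons_iff.1 hb
  exact ⟨π₁, π₂, d, rfl, hc, he, hd⟩

theorem IsPath.reflTransGen_substStep (h : D.IsPreTOD ord) {a b : ℕ}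
    {π : List (ℕ × Option EdgeLabel)} (hπ : D.IsPath a π b) (hσ : D.IsSubstPath ord σ π) :
    Relation.ReflTransGen (D.SubstStep ord σ) a b := by
  induction hπ with
  | nil _ => exact .refl
  | @cons a c b ℓ π he _ ih =>
    refine .head ⟨he.1, h.ne_exit_of_edge he, ?_⟩ (ih fun p hp => hσ p (.tail _ hp))
    rw [← NodeLabel.eq_eval_of_mem_out he.2.1 (hσ (a, ℓ) (.head _))]
    exact he.2.2

theorem IsPreTOD.exists_isSubstPath (h : D.IsPreTOD ord) {a b : ℕ}
    (hab : Relation.ReflTransGen (D.SubstStep ord σ) a b) (hb : b ∈ D.nodes) :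
    ∃ π, D.IsPath a π b ∧ D.IsSubstPath ord σ π := by
  induction hab using Relation.ReflTransGen.head_induction_on with
  | refl => exact ⟨[], .nil hb, fun p hp => absurd hp List.not_mem_nil⟩
  | @head a c hac _ ih =>
    obtain ⟨π, hπ, hσ⟩ := ih
    refine ⟨_, .cons (hac.edge h) hπ, fun p hp => ?_⟩
    obtain rfl | hp := List.mem_cons.1 hp
    · exact fun _ => rfl
    · exact hσ p hp

theorem IsPreTOD.exists_isTraversal (h : D.IsPreTOD ord) {n : ℕ} (hn : n ∈ D.nodes)
    (hx : n ≠ D.exit) (hr : Relation.ReflTransGen (D.SubstStep ord σ) D.root n) :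
    ∃ π, D.IsTraversal ord σ π ∧ ∃ p ∈ π, p.1 = n := by
  obtain ⟨π, hπ, hσ⟩ := h.exists_isSubstPath hr hn
  obtain ⟨π', hπ', hσ'⟩ := h.exists_isSubstPath (h.reaches_exit σ hn).2 h.exit_mem
  refine ⟨π ++ π', ⟨hπ.append hπ', fun p hp => ?_⟩, ?_⟩
  · exact (List.mem_append.1 hp).elim (hσ p) (hσ' p)
  · cases hπ' with
    | nil _ => exact absurd rfl hx
    | cons _ _ => exact ⟨_, List.mem_append_right _ (.head _), rfl⟩

theorem IsPreTOD.successSet_eq (h : D.IsPreTOD ord) (σ : Subst L V) :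
    D.successSet ord σ = D.collect ord σ D.root := by
  ext q
  constructor
  · rintro ⟨π, ⟨hπ, hσ⟩, p, hp, hq⟩
    obtain ⟨π₁, π₂, c, rfl, hπ₁, he, -⟩ := hπ.exists_split hp
    exact ⟨p.1, he.1, hπ₁.reflTransGen_substStep h fun x hx => hσ x (by simp [hx]), hq⟩
  · rintro ⟨n, hn, hr, hq⟩
    have hx : n ≠ D.exit := h.ne_exit_of_isEval_or_isSuccess (.inr (hq ▸ trivial))
    obtain ⟨π, hπ, p, hp, rfl⟩ := h.exists_isTraversal hn hx hr
    exact ⟨π, hπ, p, hp, hq⟩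

theorem IsPreTOD.equivalent (h : D.IsPreTOD ord) (h' : D'.IsPreTOD ord)
    (hcollect : ∀ σ, D.collect ord σ D.root = D'.collect ord σ D'.root) :
    D.Equivalent ord D' := fun σ => by
  rw [h.successSet_eq, h'.successSet_eq, hcollect]

end Paths

section Cleanup

variable {L : FirstOrder.Language.{u, v}} {V : Type w} {ord : TermOrdering L V}
  {D D' D'' : Diagram L V}

/- Along the steps of `σ`, `D.collect` is determined by the recursion `collect_of_substStep`, so it
suffices that `D'.collect` satisfies this recursion of `D`. -/
theorem collect_eq_of_step (h : D.IsPreTOD ord) (h' : D'.IsPreTOD ord) (hexit : D'.exit = D.exit)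
    {σ : Subst L V} {a : ℕ} (ha : a ∈ D.nodes)
    (hstep : ∀ b c, Relation.ReflTransGen (D.SubstStep ord σ) a b → D.SubstStep ord σ b c →
      D'.collect ord σ b = {q | D.label b = .success q.1 q.2} ∪ D'.collect ord σ c) :
    D.collect ord σ a = D'.collect ord σ a := by
  obtain ⟨-, hsteps⟩ := h.reaches_exit σ ha
  induction hsteps using Relation.ReflTransGen.head_induction_on with
  | refl => rw [collect_exit h, ← hexit, collect_exit h']
  | @head b c hbc _ ih =>
    have hc : c ∈ D.nodes := (h.target _ _ _ (hbc.edge h)).1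
    rw [collect_of_substStep hbc, hstep b c .refl hbc,
      ih hc fun b' c' hb' => hstep b' c' (hb'.head hbc)]

/-- `D'` is `D` restricted to a set of nodes that is closed under outgoing edges and keeps the root,
as happens when nodes without incoming edges are removed. -/
structure Trims (D D' : Diagram L V) : Prop where
  eq_of_nodes : D' = { D with nodes := D'.nodes }
  sub : D'.nodes ⊆ D.nodes
  root_mem : D.root ∈ D.nodes → D.root ∈ D'.nodes
  target_mem : ∀ m ℓ n, D.Edge m ℓ n → n ∈ D.nodes → m ∈ D'.nodes → n ∈ D'.nodes

namespace Trims

theorem refl (D : Diagram L V) : Trims D D :=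
  ⟨rfl, subset_rfl, id, fun _ _ _ _ hn _ => hn⟩

theorem root_eq (h : Trims D D') : D'.root = D.root := by rw [h.eq_of_nodes]

theorem exit_eq (h : Trims D D') : D'.exit = D.exit := by rw [h.eq_of_nodes]

theorem label_eq (h : Trims D D') : D'.label = D.label := by rw [h.eq_of_nodes]

theorem next_eq (h : Trims D D') : D'.next = D.next := by rw [h.eq_of_nodes]

theorem edge_iff (h : Trims D D') {m n : ℕ} {ℓ : Option EdgeLabel} :
    D'.Edge m ℓ n ↔ D.Edge m ℓ n ∧ m ∈ D'.nodes := by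
  rw [Edge, Edge, h.label_eq, h.next_eq]
  exact ⟨fun he => ⟨⟨h.sub he.1, he.2⟩, he.1⟩, fun he => ⟨he.2, he.1.2⟩⟩

theorem trans (h : Trims D D') (h' : Trims D' D'') : Trims D D'' where
  eq_of_nodes := by rw [h'.eq_of_nodes, h.eq_of_nodes]
  sub := h'.sub.trans h.sub
  root_mem hr := h.root_eq ▸ h'.root_mem (h.root_eq ▸ h.root_mem hr)
  target_mem m ℓ n he hn hm :=
    h'.target_mem m ℓ n (h.edge_iff.2 ⟨he, h'.sub hm⟩) (h.target_mem m ℓ n he hn (h'.sub hm)) hm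

theorem isPreTOD (h : Trims D D') (hD : D.IsPreTOD ord) : D'.IsPreTOD ord where
  root_mem := h.root_eq ▸ h.root_mem hD.root_mem
  label_root := by rw [h.root_eq, h.label_eq, hD.label_root]
  label_exit := by rw [h.exit_eq, h.label_eq, hD.label_exit]
  isInner_label n hn := by
    rw [h.root_eq, h.exit_eq, h.label_eq]
    exact hD.isInner_label n (h.sub hn)
  target m ℓ n he := by
    obtain ⟨he, hm⟩ := h.edge_iff.1 he
    obtain ⟨hn, hr⟩ := hD.target m ℓ n he
    exact ⟨h.target_mem m ℓ n he hn hm, by rwa [h.root_eq]⟩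
  acyclic n hn :=
    hD.acyclic n (hn.lift id fun _ _ ⟨ℓ, he⟩ => ⟨ℓ, (h.edge_iff.1 he).1⟩)

theorem isPath (h : Trims D D') (hD : D.IsPreTOD ord) {a b : ℕ}
    {π : List (ℕ × Option EdgeLabel)} (hπ : D.IsPath a π b) (ha : a ∈ D'.nodes) :
    D'.IsPath a π b := by
  induction hπ with
  | nil _ => exact .nil ha
  | cons he _ ih =>
    exact .cons (h.edge_iff.2 ⟨he, ha⟩) (ih (h.target_mem _ _ _ he (hD.target _ _ _ he).1 ha))

theorem collect_root_eq (h : Trims D D') (hD : D.IsPreTOD ord) (σ : Subst L V) :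
    D.collect ord σ D.root = D'.collect ord σ D.root := by
  have hD' := h.isPreTOD hD
  have hroot : D.root ∈ D'.nodes := h.root_mem hD.root_mem
  refine (collect_eq_of_step hD' hD h.exit_eq.symm hroot fun b c _ hbc => ?_).symm
  obtain ⟨hb, hx, hnext⟩ := hbc
  rw [h.label_eq, h.next_eq] at hnext
  rw [collect_of_substStep ⟨h.sub hb, h.exit_eq ▸ hx, hnext⟩, h.label_eq]

end Trims

theorem RemoveOrphan.trims (h : RemoveOrphan D D') : Trims D D' := by
  obtain ⟨n, -, hr, hin, rfl⟩ := h
  refine ⟨rfl, Finset.erase_subset _ _, fun h => Finset.mem_erase.2 ⟨hr.symm, h⟩, ?_⟩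
  intro m ℓ x he hx _
  refine Finset.mem_erase.2 ⟨?_, hx⟩
  rintro rfl
  exact Set.eq_empty_iff_forall_notMem.1 hin (m, ℓ) he

theorem Cleanup.trims (h : Cleanup D D') : Trims D D' := by
  obtain ⟨hsteps, -⟩ := h
  induction hsteps with
  | refl => exact .refl D
  | tail _ hstep ih => exact ih.trans hstep.trims

theorem Cleanup.isTOD (h : Cleanup D D') (hD : D.IsPreTOD ord) : D'.IsTOD ord :=
  (h.trims.isPreTOD hD).isTOD h.2

theorem IsTOD.cleanup_self (h : D.IsTOD ord) : Cleanup D D :=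
  ⟨.refl, h.noOrphan⟩

end Cleanup

section LocalChange

variable {L : FirstOrder.Language.{u, v}} {V : Type w} {ord : TermOrdering L V}
  {D D' : Diagram L V}

/-- `D'` arises from `D` by a change at the node `n` that affects no success set: edges are changed
only if they enter or leave `n`, and new edges lead to new nodes or to targets of edges of `n`. -/
structure LocalChange (ord : TermOrdering L V) (D : Diagram L V) (n : ℕ) (D' : Diagram L V) :
    Prop where
  isPreTOD : D'.IsPreTOD ord
  root_eq : D'.root = D.root
  exit_eq : D'.exit = D.exit
  nodes_sub : D.nodes ⊆ D'.nodes
  edge_of_not_adj : ∀ x ℓ y, y ∈ D.nodes → ¬ D.Adj n y → D'.Edge x ℓ y → D.Edge x ℓ y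
  edge_of_ne : ∀ x ℓ y, x ≠ n → y ≠ n → D.Edge x ℓ y → D'.Edge x ℓ y
  collect_eq : ∀ σ, D.collect ord σ D.root = D'.collect ord σ D.root

section Reroute

variable {P : ℕ → Option EdgeLabel → Prop} [DecidableRel P] {n n' x y : ℕ} {ℓ : Option EdgeLabel}

/-- Let the edges selected by `P` (by source and label) point to `n'`; the common form of
`redirect` and `replaceNode`. -/
def reroute (D : Diagram L V) (P : ℕ → Option EdgeLabel → Prop) [DecidableRel P] (n' : ℕ) :
    Diagram L V :=
  { D with next := fun a b => if P a b then n' else D.next a b }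

theorem Edge.reroute (he : D.Edge x ℓ y) (hP : P x ℓ) : (D.reroute P n').Edge x ℓ n' :=
  ⟨he.1, he.2.1, if_pos hP⟩

theorem Edge.reroute_of_not (he : D.Edge x ℓ y) (hP : ¬ P x ℓ) : (D.reroute P n').Edge x ℓ y :=
  ⟨he.1, he.2.1, (if_neg hP).trans he.2.2⟩

theorem Edge.of_reroute (he : (D.reroute P n').Edge x ℓ y) :
    (P x ℓ ∧ y = n' ∧ D.Edge x ℓ (D.next x ℓ)) ∨ (¬ P x ℓ ∧ D.Edge x ℓ y) := by
  obtain ⟨hx, hℓ, hy⟩ := he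
  by_cases hP : P x ℓ
  · exact .inl ⟨hP, hy.symm.trans (if_pos hP), hx, hℓ, rfl⟩
  · exact .inr ⟨hP, hx, hℓ, (if_neg hP).symm.trans hy⟩

theorem IsPreTOD.isPreTOD_reroute (h : D.IsPreTOD ord)
    (hP : ∀ x ℓ y, D.Edge x ℓ y → P x ℓ → y = n) (hn : D.Adj n n') :
    (D.reroute P n').IsPreTOD ord := by
  have transGen : ∀ x y, (D.reroute P n').Adj x y → Relation.TransGen D.Adj x y := by
    rintro x y ⟨ℓ, he⟩
    obtain ⟨hPx, rfl, he'⟩ | ⟨-, he⟩ := he.of_reroute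
    · have hxn : D.next x ℓ = n := hP _ _ _ he' hPx
      exact .tail (.single ⟨ℓ, hxn ▸ he'⟩) hn
    · exact .single ⟨ℓ, he⟩
  refine ⟨h.root_mem, h.label_root, h.label_exit, h.isInner_label, fun x ℓ y he => ?_,
    fun a ha => h.acyclic a (ha.lift' id transGen)⟩
  obtain ⟨_, -, ℓ', he'⟩ := Relation.TransGen.tail'_iff.1 (transGen x y ⟨ℓ, he⟩)
  exact h.target _ _ _ he'

theorem IsPreTOD.collect_reroute (h : D.IsPreTOD ord)
    (hP : ∀ x ℓ y, D.Edge x ℓ y → P x ℓ → y = n) (hn : D.Adj n n') {σ : Subst L V}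
    (heval : Relation.ReflTransGen (D.SubstStep ord σ) D.root n → D.EvalStep ord σ n n') :
    D.collect ord σ D.root = (D.reroute P n').collect ord σ D.root := by
  have h' := h.isPreTOD_reroute hP hn
  refine collect_eq_of_step h h' rfl h.root_mem fun a b ha hab => ?_
  have he := hab.edge h
  by_cases hPa : P a (ord.eval σ (D.label a))
  · obtain rfl : b = n := hP _ _ _ he hPa
    obtain ⟨hbmem, hbeval, hbnext⟩ := heval (ha.tail hab)
    have hPb : ¬ P b (ord.eval σ (D.label b)) := fun hPb => by
      have he := h.edge_eval σ hbmem (h.ne_exit_of_isEval_or_isSuccess (.inl hbeval))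
      exact h.ne_of_edge he (hP _ _ _ he hPb).symm
    have hb : (D.reroute P n').EvalStep ord σ b n' :=
      ⟨hbmem, hbeval, (if_neg hPb).trans hbnext⟩
    have ha' : (D.reroute P n').SubstStep ord σ a n' := ⟨hab.1, hab.2.1, if_pos hPa⟩
    rw [collect_of_substStep ha', collect_eq_of_evalStep h' hb]
    rfl
  · have ha' : (D.reroute P n').SubstStep ord σ a b :=
      ⟨hab.1, hab.2.1, (if_neg hPa).trans hab.2.2⟩
    rw [collect_of_substStep ha']
    rfl

theorem IsPreTOD.localChange_reroute (h : D.IsPreTOD ord)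
    (hP : ∀ x ℓ y, D.Edge x ℓ y → P x ℓ → y = n) (hn : D.Adj n n')
    (heval : ∀ σ, Relation.ReflTransGen (D.SubstStep ord σ) D.root n → D.EvalStep ord σ n n') :
    LocalChange ord D n (D.reroute P n') where
  isPreTOD := h.isPreTOD_reroute hP hn
  root_eq := rfl
  exit_eq := rfl
  nodes_sub := subset_rfl
  edge_of_not_adj x ℓ y _ hy he := by
    obtain ⟨-, rfl, -⟩ | ⟨-, he⟩ := he.of_reroute
    · exact absurd hn hy
    · exact he
  edge_of_ne x ℓ y _ hy he := he.reroute_of_not fun hPx => hy (hP _ _ _ he hPx)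
  collect_eq σ := h.collect_reroute hP hn (heval σ)

end Reroute

theorem Edge.redirect {m n n' : ℕ} {ℓ : Option EdgeLabel} (he : D.Edge m ℓ n) :
    (D.redirect m ℓ n').Edge m ℓ n' :=
  Edge.reroute (P := fun a b => a = m ∧ b = ℓ) he ⟨rfl, rfl⟩

theorem Edge.replaceNode {m n n' : ℕ} {ℓ : Option EdgeLabel} (he : D.Edge m ℓ n) :
    (D.replaceNode n n').Edge m ℓ n' :=
  Edge.reroute (P := fun a b => D.next a b = n) he he.2.2

theorem IsPreTOD.localChange_redirect (h : D.IsPreTOD ord) {m n n' : ℕ} {ℓ' : Option EdgeLabel}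
    {ℓ : EdgeLabel} (hm : D.Edge m ℓ' n) (hn : D.Edge n (some ℓ) n') (hforces : D.Forces ord n ℓ) :
    LocalChange ord D n (D.redirect m ℓ' n') := by
  refine h.localChange_reroute (P := fun a b => a = m ∧ b = ℓ') ?_ ⟨_, hn⟩ fun σ hσ => ?_
  · rintro x k y he ⟨rfl, rfl⟩
    exact he.2.2.symm.trans hm.2.2
  · have hx := h.ne_exit_of_isEval_or_isSuccess (.inl hforces.1)
    obtain ⟨π, hπ, hmem⟩ := h.exists_isTraversal hn.1 hx hσ
    exact ⟨hn.1, hforces.1, hforces.2 σ π hπ hmem ▸ hn.2.2⟩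

theorem IsPreTOD.localChange_replaceNode (h : D.IsPreTOD ord) {n n' : ℕ} (hn : D.Adj n n')
    (heval : ∀ σ, D.EvalStep ord σ n n') : LocalChange ord D n (D.replaceNode n n') :=
  h.localChange_reroute (P := fun a b => D.next a b = n) (fun _ _ _ he hP => he.2.2.symm.trans hP)
    hn fun σ _ => heval σ

section Replicate

variable {m n n' x y : ℕ} {ℓ ℓ' : Option EdgeLabel}

/-- The diagram that results from replicating the node `n` for its incoming edge from `m` labelled
`ℓ`; the copy is `n'`. -/
def replicate (D : Diagram L V) (m : ℕ) (ℓ : Option EdgeLabel) (n n' : ℕ) : Diagram L V :=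
  { D with
    nodes := insert n' D.nodes
    label := fun a => if a = n' then D.label n else D.label a
    next := fun a b =>
      if a = m ∧ b = ℓ then n' else if a = n' then D.next n b else D.next a b }

theorem replicate_label_of_mem (hn' : n' ∉ D.nodes) {a : ℕ} (ha : a ∈ D.nodes) :
    (D.replicate m ℓ n n').label a = D.label a :=
  if_neg (ne_of_mem_of_not_mem ha hn')

theorem replicate_label_copy : (D.replicate m ℓ n n').label n' = D.label n :=
  if_pos rfl

theorem replicate_next_copy (hm : m ∈ D.nodes) (hn' : n' ∉ D.nodes) :
    (D.replicate m ℓ n n').next n' ℓ' = D.next n ℓ' :=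
  (if_neg fun h => ne_of_mem_of_not_mem hm hn' h.1.symm).trans (if_pos rfl)

theorem replicate_next_of_mem (hn' : n' ∉ D.nodes) (hx : x ∈ D.nodes) (hne : ¬ (x = m ∧ ℓ' = ℓ)) :
    (D.replicate m ℓ n n').next x ℓ' = D.next x ℓ' :=
  (if_neg hne).trans (if_neg (ne_of_mem_of_not_mem hx hn'))

theorem Edge.replicate_of_ne (he : D.Edge x ℓ' y) (hn' : n' ∉ D.nodes)
    (hne : ¬ (x = m ∧ ℓ' = ℓ)) : (D.replicate m ℓ n n').Edge x ℓ' y :=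
  ⟨Finset.mem_insert_of_mem he.1, (replicate_label_of_mem hn' he.1).symm ▸ he.2.1,
    (replicate_next_of_mem hn' he.1 hne).trans he.2.2⟩

theorem Edge.replicate (he : D.Edge m ℓ n) (hn' : n' ∉ D.nodes) :
    (D.replicate m ℓ n n').Edge m ℓ n' :=
  ⟨Finset.mem_insert_of_mem he.1, (replicate_label_of_mem hn' he.1).symm ▸ he.2.1,
    if_pos ⟨rfl, rfl⟩⟩

theorem Edge.of_replicate (he : (D.replicate m ℓ n n').Edge x ℓ' y) (hm : m ∈ D.nodes)
    (hn : n ∈ D.nodes) (hn' : n' ∉ D.nodes) :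
    (x = m ∧ y = n') ∨ (x = n' ∧ D.Edge n ℓ' y) ∨ D.Edge x ℓ' y := by
  obtain ⟨hx, hℓ, rfl⟩ := he
  obtain rfl | hx := Finset.mem_insert.1 hx
  · rw [replicate_label_copy] at hℓ
    exact .inr (.inl ⟨rfl, hn, hℓ, (replicate_next_copy hm hn').symm⟩)
  · rw [replicate_label_of_mem hn' hx] at hℓ
    by_cases hne : x = m ∧ ℓ' = ℓ
    · exact .inl ⟨hne.1, if_pos hne⟩
    · exact .inr (.inr ⟨hx, hℓ, (replicate_next_of_mem hn' hx hne).symm⟩)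

theorem IsPreTOD.isPreTOD_replicate (h : D.IsPreTOD ord) (hm : D.Edge m ℓ n) (hnx : n ≠ D.exit)
    (hn' : n' ∉ D.nodes) : (D.replicate m ℓ n n').IsPreTOD ord := by
  obtain ⟨hn, hnr⟩ := h.target _ _ _ hm
  have hne : ∀ {a}, a ∈ D.nodes → a ≠ n' := fun ha => ne_of_mem_of_not_mem ha hn'
  have old : ∀ {x k y}, D.Edge x k y → y ∈ insert n' D.nodes ∧ y ≠ D.root := fun he =>
    ⟨Finset.mem_insert_of_mem (h.target _ _ _ he).1, (h.target _ _ _ he).2⟩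
  constructor
  · exact Finset.mem_insert_of_mem h.root_mem
  · exact (replicate_label_of_mem hn' h.root_mem).trans h.label_root
  · exact (replicate_label_of_mem hn' h.exit_mem).trans h.label_exit
  · intro a ha har hax
    obtain rfl | ha := Finset.mem_insert.1 ha
    · rw [replicate_label_copy]
      exact h.isInner_label n hn hnr hnx
    · rw [replicate_label_of_mem hn' ha]
      exact h.isInner_label a ha har hax
  · intro x k y he
    obtain ⟨-, rfl⟩ | ⟨-, he⟩ | he := he.of_replicate hm.1 hn hn'
    · exact ⟨Finset.mem_insert_self _ _, (hne h.root_mem).symm⟩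
    · exact old he
    · exact old he
  · obtain ⟨r, hr⟩ := h.exists_rank
    refine acyclic_of_rank (fun a => r (if a = n' then n else a)) ?_
    rintro x y ⟨k, he⟩
    obtain ⟨rfl, rfl⟩ | ⟨rfl, he'⟩ | he := he.of_replicate hm.1 hn hn'
    · simpa only [if_pos, if_neg (hne hm.1)] using hr _ _ ⟨ℓ, hm⟩
    · simpa only [if_pos, if_neg (hne (h.target _ _ _ he').1)] using hr _ _ ⟨k, he'⟩
    · simpa only [if_neg (hne he.1), if_neg (hne (h.target _ _ _ he).1)] using hr _ _ ⟨k, he⟩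

theorem IsPreTOD.collect_replicate (h : D.IsPreTOD ord) (hm : D.Edge m ℓ n) (hnx : n ≠ D.exit)
    (hn' : n' ∉ D.nodes) (σ : Subst L V) :
    D.collect ord σ D.root = (D.replicate m ℓ n n').collect ord σ D.root := by
  have h' := h.isPreTOD_replicate hm hnx hn'
  have hn := (h.target _ _ _ hm).1
  have copy : (D.replicate m ℓ n n').collect ord σ n' = (D.replicate m ℓ n n').collect ord σ n := by
    refine collect_eq_of_next (Finset.mem_insert_self _ _) (Finset.mem_insert_of_mem hn)
      (ne_of_mem_of_not_mem h.exit_mem hn').symm hnx ?_ ?_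
    · rw [replicate_label_of_mem hn' hn, replicate_label_copy]
    · rw [replicate_label_of_mem hn' hn, replicate_label_copy, replicate_next_copy hm.1 hn',
        replicate_next_of_mem hn' hn fun heq => h.ne_of_edge hm heq.1.symm]
  refine collect_eq_of_step h h' rfl h.root_mem fun a b _ hab => ?_
  have hl := replicate_label_of_mem (m := m) (ℓ := ℓ) (n := n) hn' hab.1
  have hstep : (D.replicate m ℓ n n').SubstStep ord σ a _ :=
    ⟨Finset.mem_insert_of_mem hab.1, hab.2.1, rfl⟩
  rw [collect_of_substStep hstep, hl]
  congr 1
  by_cases hedge : a = m ∧ ord.eval σ (D.label a) = ℓ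
  · obtain ⟨rfl, rfl⟩ := hedge
    obtain rfl : b = n := hab.2.2.symm.trans hm.2.2
    rw [← copy]
    exact congrArg _ (if_pos ⟨rfl, rfl⟩)
  · rw [replicate_next_of_mem hn' hab.1 hedge, hab.2.2]

theorem IsPreTOD.localChange_replicate (h : D.IsPreTOD ord) (hm : D.Edge m ℓ n) (hnx : n ≠ D.exit)
    (hn' : n' ∉ D.nodes) : LocalChange ord D n (D.replicate m ℓ n n') where
  isPreTOD := h.isPreTOD_replicate hm hnx hn'
  root_eq := rfl
  exit_eq := rfl
  nodes_sub := Finset.subset_insert _ _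
  edge_of_not_adj x k y hy hny he := by
    obtain ⟨-, rfl⟩ | ⟨-, he⟩ | he := he.of_replicate hm.1 (h.target _ _ _ hm).1 hn'
    · exact absurd hy hn'
    · exact absurd ⟨_, he⟩ hny
    · exact he
  edge_of_ne x k y _ hy he := by
    refine he.replicate_of_ne hn' ?_
    rintro ⟨rfl, rfl⟩
    exact hy (he.2.2.symm.trans hm.2.2)
  collect_eq := h.collect_replicate hm hnx hn'

theorem NoOrphan.replicate (ho : D.NoOrphan) (hm : D.Edge m ℓ n) (hn' : n' ∉ D.nodes)
    (hin : (D.inEdges n).Nontrivial) : (D.replicate m ℓ n n').NoOrphan := by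
  intro a ha har
  obtain rfl | ha := Finset.mem_insert.1 ha
  · exact ⟨(m, ℓ), hm.replicate hn'⟩
  · by_cases han : a = n
    · subst han
      obtain ⟨⟨x, k⟩, he, hne⟩ := hin.exists_ne (m, ℓ)
      exact ⟨(x, k), Edge.replicate_of_ne he hn' fun heq => hne (Prod.ext heq.1 heq.2)⟩
    · obtain ⟨⟨x, k⟩, he⟩ := ho a ha har
      refine ⟨(x, k), Edge.replicate_of_ne he hn' ?_⟩
      rintro ⟨rfl, rfl⟩
      exact han (he.2.2.symm.trans hm.2.2)

end Replicate

end LocalChange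

section Refines

variable {L : FirstOrder.Language.{u, v}} {V : Type w} {ord : TermOrdering L V}
  {D D' : Diagram L V} {ι : Type} {n : ℕ} {ν : ι → ℕ} {d : ι → ℕ}

/-- The places to which an edge of a refining subgraph may lead: out of the subgraph to a target of
an edge of `n`, or to a new node of greater depth `d`. The source of the edge is given by `o`, where
`none` stands for `n`, the first node of the subgraph, and `some i` for `ν i`. -/
def LeadsDown (D : Diagram L V) (n : ℕ) (ν d : ι → ℕ) (o : Option ι) (y : ℕ) : Prop :=
  D.Adj n y ∨ ∃ j, y = ν j ∧ ∀ i ∈ o, d i < d j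

/-- The node of a refining subgraph given by `o` is an evaluation node whose edges stay in the
subgraph or leave it as the edges of `n` do. -/
structure RefinesAt (ord : TermOrdering L V) (D : Diagram L V) (n : ℕ) (ν d : ι → ℕ)
    (D' : Diagram L V) (o : Option ι) : Prop where
  isEval : (D'.label (o.elim n ν)).IsEval
  isKBO_of_pos : ∀ e, D'.label (o.elim n ν) = .pos e → ord.IsKBO
  leadsDown : ∀ ℓ ∈ (D'.label (o.elim n ν)).out, D.LeadsDown n ν d o (D'.next (o.elim n ν) ℓ)

/-- The evaluation node `n` is refined to a subgraph of evaluation nodes, which consists of `n` and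
the new nodes `ν i`; it has no cycles, since its edges increase the depth `d`, and for every `σ` it
is left to where `σ` leaves the original `n`. -/
structure Refines (ord : TermOrdering L V) (D : Diagram L V) (n : ℕ) (ν d : ι → ℕ)
    (D' : Diagram L V) : Prop where
  ext : D.Extends n ν D'
  refinesAt : ∀ o, D.RefinesAt ord n ν d D' o
  exists_evalStep : ∀ σ, ∃ y, D.EvalStep ord σ n y ∧ Relation.ReflTransGen (D'.EvalStep ord σ) n y

namespace Extends

theorem nodes_sub (h : D.Extends n ν D') : D.nodes ⊆ D'.nodes :=
  fun a ha => (h.nodes_eq a).2 (.inl ha)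

theorem new_mem (h : D.Extends n ν D') (i : ι) : ν i ∈ D'.nodes :=
  (h.nodes_eq _).2 (.inr ⟨i, rfl⟩)

theorem ne_new (h : D.Extends n ν D') {a : ℕ} (ha : a ∈ D.nodes) (i : ι) : a ≠ ν i :=
  ne_of_mem_of_not_mem ha (h.fresh i)

theorem mem_cases (h : D.Extends n ν D') {a : ℕ} (ha : a ∈ D'.nodes) :
    (a ≠ n ∧ a ∈ D.nodes) ∨ ∃ o : Option ι, a = o.elim n ν := by
  by_cases han : a = n
  · exact .inr ⟨none, han⟩
  · obtain ha | ⟨i, rfl⟩ := (h.nodes_eq a).1 ha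
    · exact .inl ⟨han, ha⟩
    · exact .inr ⟨some i, rfl⟩

theorem edge_iff_of_ne (h : D.Extends n ν D') {x y : ℕ} {ℓ : Option EdgeLabel} (hx : x ∈ D.nodes)
    (hxn : x ≠ n) : D'.Edge x ℓ y ↔ D.Edge x ℓ y := by
  rw [Edge, Edge, h.label_eq x hx hxn, h.next_eq x hx hxn]
  exact and_congr_left' (iff_of_true (h.nodes_sub hx) hx)

end Extends

namespace Refines

theorem evalStep_self (h : D.Refines ord n ν d D') : ∃ y, D.EvalStep ord (Subst.id L V) n y :=
  (h.exists_evalStep _).imp fun _ => And.left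

theorem mem (h : D.Refines ord n ν d D') : n ∈ D.nodes := h.evalStep_self.choose_spec.1

theorem edge_cases (h : D.Refines ord n ν d D') {x y : ℕ} {ℓ : Option EdgeLabel}
    (he : D'.Edge x ℓ y) :
    (x ≠ n ∧ D.Edge x ℓ y) ∨ ∃ o : Option ι, x = o.elim n ν ∧ D.LeadsDown n ν d o y := by
  obtain ⟨hxn, hx⟩ | ⟨o, rfl⟩ := h.ext.mem_cases he.1
  · exact .inl ⟨hxn, (h.ext.edge_iff_of_ne hx hxn).1 he⟩
  · exact .inr ⟨o, rfl, he.2.2 ▸ (h.refinesAt o).leadsDown ℓ he.2.1⟩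

theorem exists_rank (h : D.Refines ord n ν d D') (hD : D.IsPreTOD ord) :
    ∃ r : ℕ → ℕ ×ₗ ℤ, ∀ a b, D'.Adj a b → r b < r a := by
  obtain ⟨r, hr⟩ := hD.exists_rank
  have extend_old : ∀ {β : Type} (f : ι → β) (g : ℕ → β), ∀ a ∈ D.nodes,
      Function.extend ν f g a = g a := fun f g a ha =>
    Function.extend_apply' f g a fun ⟨i, hi⟩ => h.ext.ne_new ha i hi.symm
  refine ⟨fun a => toLex (Function.extend ν (fun _ => r n) r a,
    Function.extend ν (fun i => -(d i : ℤ) - 1) 0 a), ?_⟩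
  rintro x y ⟨ℓ, he⟩
  rw [Prod.Lex.toLex_lt_toLex]
  obtain ⟨-, he⟩ | ⟨o, rfl, ⟨k, he'⟩ | ⟨j, rfl, hd⟩⟩ := h.edge_cases he
  · left
    simpa only [extend_old _ _ _ he.1, extend_old _ _ _ (hD.target _ _ _ he).1]
      using hr _ _ ⟨ℓ, he⟩
  · left
    have hlt := hr _ _ ⟨k, he'⟩
    cases o <;> simpa only [Option.elim, h.ext.injective.extend_apply, extend_old _ _ _ h.mem,
      extend_old _ _ _ (hD.target _ _ _ he').1] using hlt
  · right
    cases o with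
    | none =>
      simp only [Option.elim, h.ext.injective.extend_apply, extend_old _ _ _ h.mem, Pi.zero_apply,
        true_and]
      omega
    | some i =>
      have hlt := hd i rfl
      simp only [Option.elim, h.ext.injective.extend_apply, true_and]
      omega

theorem isPreTOD (h : D.Refines ord n ν d D') (hD : D.IsPreTOD ord) : D'.IsPreTOD ord := by
  obtain ⟨-, -, heval, -⟩ := h.evalStep_self
  have hroot := (hD.ne_root_of_isEval_or_isSuccess (.inl heval)).symm
  have hexit := (hD.ne_exit_of_isEval_or_isSuccess (.inl heval)).symm
  constructor
  · exact h.ext.root_eq ▸ h.ext.nodes_sub hD.root_mem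
  · rw [h.ext.root_eq, h.ext.label_eq _ hD.root_mem hroot, hD.label_root]
  · rw [h.ext.exit_eq, h.ext.label_eq _ hD.exit_mem hexit, hD.label_exit]
  · intro a ha har hax
    obtain ⟨han, ha⟩ | ⟨o, rfl⟩ := h.ext.mem_cases ha
    · rw [h.ext.label_eq a ha han]
      exact hD.isInner_label a ha (h.ext.root_eq ▸ har) (h.ext.exit_eq ▸ hax)
    · refine ⟨fun hl => ?_, fun hl => ?_, (h.refinesAt o).isKBO_of_pos⟩ <;>
      · have heval := (h.refinesAt o).isEval
        rw [hl] at heval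
        exact heval
  · intro x k y he
    have old : ∀ {x k}, D.Edge x k y → y ∈ D'.nodes ∧ y ≠ D'.root := fun he =>
      ⟨h.ext.nodes_sub (hD.target _ _ _ he).1, h.ext.root_eq ▸ (hD.target _ _ _ he).2⟩
    obtain ⟨-, he⟩ | ⟨o, -, ⟨k, he⟩ | ⟨j, rfl, -⟩⟩ := h.edge_cases he
    · exact old he
    · exact old he
    · exact ⟨h.ext.new_mem j, h.ext.root_eq ▸ (h.ext.ne_new hD.root_mem j).symm⟩
  · obtain ⟨r, hr⟩ := h.exists_rank hD
    exact acyclic_of_rank r hr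

theorem collect_eq (h : D.Refines ord n ν d D') (hD : D.IsPreTOD ord) (σ : Subst L V) :
    D.collect ord σ D.root = D'.collect ord σ D.root := by
  have hD' := h.isPreTOD hD
  refine collect_eq_of_step hD hD' h.ext.exit_eq hD.root_mem fun a b _ hab => ?_
  by_cases han : a = n
  · subst han
    obtain ⟨y, hy, hsteps⟩ := h.exists_evalStep σ
    obtain rfl : b = y := hab.2.2.symm.trans hy.2.2
    rw [collect_eq_of_evalSteps hD' hsteps, setOf_label_eq_success_of_isEval hy.2.1,
      Set.empty_union]
  · have hl := h.ext.label_eq a hab.1 han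
    have ha' : D'.SubstStep ord σ a b := by
      refine ⟨h.ext.nodes_sub hab.1, h.ext.exit_eq ▸ hab.2.1, ?_⟩
      rw [hl, h.ext.next_eq a hab.1 han, hab.2.2]
    rw [collect_of_substStep ha', hl]

theorem localChange (h : D.Refines ord n ν d D') (hD : D.IsPreTOD ord) :
    LocalChange ord D n D' where
  isPreTOD := h.isPreTOD hD
  root_eq := h.ext.root_eq
  exit_eq := h.ext.exit_eq
  nodes_sub := h.ext.nodes_sub
  edge_of_not_adj x ℓ y hy hny he := by
    obtain ⟨-, he⟩ | ⟨o, -, hadj | ⟨j, rfl, -⟩⟩ := h.edge_cases he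
    · exact he
    · exact absurd hadj hny
    · exact absurd hy (h.ext.fresh j)
  edge_of_ne x ℓ y hxn _ he := (h.ext.edge_iff_of_ne he.1 hxn).2 he
  collect_eq := h.collect_eq hD

theorem edge_of_edge_self (h : D.Refines ord n ν d D') (hD : D.IsPreTOD ord) {x : ℕ}
    {ℓ : Option EdgeLabel} (he : D.Edge x ℓ n) : D'.Edge x ℓ n :=
  (h.ext.edge_iff_of_ne he.1 (hD.ne_of_edge he)).2 he

end Refines

end Refines

section Chains

theorem nodeAt_of_lt {k : ℕ} (μ : Fin k → ℕ) (e : ℕ) (i : Fin k) : nodeAt μ e i = μ i :=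
  dif_pos i.2

theorem nodeAt_of_ge {k : ℕ} (μ : Fin k → ℕ) (e : ℕ) {j : ℕ} (hj : k ≤ j) : nodeAt μ e j = e :=
  dif_neg hj.not_gt

theorem nodeAt_cons_zero {k : ℕ} (n : ℕ) (μ : Fin k → ℕ) (e : ℕ) :
    nodeAt (Fin.cons n μ : Fin (k + 1) → ℕ) e 0 = n :=
  nodeAt_of_lt _ _ 0

theorem nodeAt_cons_succ {k : ℕ} (n : ℕ) (μ : Fin k → ℕ) (e j : ℕ) :
    nodeAt (Fin.cons n μ : Fin (k + 1) → ℕ) e (j + 1) = nodeAt μ e j := by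
  simp only [nodeAt, Nat.add_lt_add_iff_right]
  rfl

variable {k : ℕ} {μ : Fin k → ℕ} {e c : ℕ} {R : ℕ → ℕ → Prop} {P : Fin k → Prop}

theorem chain_cases (hpass : ∀ i, P i → R (μ i) (nodeAt μ e (i + 1))) (i : ℕ) :
    ((∀ j : Fin k, i ≤ j → P j) ∧ Relation.ReflTransGen R (nodeAt μ e i) e) ∨
      ∃ j : Fin k, i ≤ j ∧ (∀ l : Fin k, i ≤ l → l < j → P l) ∧ ¬ P j ∧
        Relation.ReflTransGen R (nodeAt μ e i) (μ j) := by
  rcases le_or_gt k i with hki | hik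
  · exact .inl ⟨fun j hj => by omega, by rw [nodeAt_of_ge μ e hki]⟩
  · have hμ : nodeAt μ e i = μ ⟨i, hik⟩ := nodeAt_of_lt μ e ⟨i, hik⟩
    by_cases hi : P ⟨i, hik⟩
    · have upward : ∀ j : Fin k, i ≤ j → (i + 1 ≤ j → P j) → P j := fun j hij hj =>
        hij.eq_or_lt.elim (fun h => (Fin.ext h : ⟨i, hik⟩ = j) ▸ hi) hj
      have hstep : R (nodeAt μ e i) (nodeAt μ e (i + 1)) := hμ ▸ hpass ⟨i, hik⟩ hi
      obtain ⟨hall, hR⟩ | ⟨j, hij, hlt, hj, hR⟩ := chain_cases hpass (i + 1)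
      · exact .inl ⟨fun j hij => upward j hij (hall j), .head hstep hR⟩
      · exact .inr ⟨j, (Nat.le_succ i).trans hij,
          fun l hil hlj => upward l hil fun h => hlt l h hlj, hj, .head hstep hR⟩
    · exact .inr ⟨⟨i, hik⟩, le_rfl, fun l hil hli => absurd hil hli.not_ge, hi, hμ ▸ .refl⟩
termination_by k - i

theorem chain_of_forall (hpass : ∀ i, P i → R (μ i) (nodeAt μ e (i + 1))) {i : ℕ}
    (hall : ∀ j : Fin k, i ≤ j → P j) : Relation.ReflTransGen R (nodeAt μ e i) e := by
  obtain ⟨-, hR⟩ | ⟨j, hij, -, hj, -⟩ := chain_cases hpass i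
  · exact hR
  · exact absurd (hall j hij) hj

theorem chain_of_exists_not (hpass : ∀ i, P i → R (μ i) (nodeAt μ e (i + 1)))
    (hfail : ∀ i, ¬ P i → R (μ i) c) {i : ℕ} (hex : ∃ j : Fin k, i ≤ j ∧ ¬ P j) :
    Relation.ReflTransGen R (nodeAt μ e i) c := by
  obtain ⟨hall, -⟩ | ⟨j, -, -, hj, hR⟩ := chain_cases hpass i
  · obtain ⟨j, hij, hj⟩ := hex
    exact absurd (hall j hij) hj
  · exact hR.tail (hfail j hj)

end Chains

section Nodes

variable {L : FirstOrder.Language.{u, v}} {V : Type w} {ord : TermOrdering L V}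
  {D : Diagram L V} {σ : Subst L V} {n a b c : ℕ} {s t : L.Term V} {e : LinExpr V}

namespace IsCmp

theorem evalStep (h : D.IsCmp n s t a b c) {ℓ : EdgeLabel} (hℓ : ord.evalCmp σ s t = ℓ) :
    D.EvalStep ord σ n (D.next n (some ℓ)) := by
  obtain ⟨hn, hl, -⟩ := h
  refine ⟨hn, hl ▸ trivial, ?_⟩
  rw [hl, TermOrdering.eval, hℓ]

theorem evalStep_gt (h : D.IsCmp n s t a b c) (hgt : ord.gt (σ.app s) (σ.app t)) :
    D.EvalStep ord σ n a :=
  h.2.2.1 ▸ h.evalStep (evalCmp_eq_gt.2 hgt)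

theorem evalStep_eq (h : D.IsCmp n s t a b c) (hgt : ¬ ord.gt (σ.app s) (σ.app t))
    (heq : σ.app s = σ.app t) : D.EvalStep ord σ n b :=
  h.2.2.2.1 ▸ h.evalStep (evalCmp_eq_eq.2 ⟨hgt, heq⟩)

theorem evalStep_ngeq (h : D.IsCmp n s t a b c) (hgt : ¬ ord.gt (σ.app s) (σ.app t))
    (hne : σ.app s ≠ σ.app t) : D.EvalStep ord σ n c :=
  h.2.2.2.2 ▸ h.evalStep (evalCmp_eq_ngeq.2 ⟨hgt, hne⟩)

theorem evalStep_of_ge (h : D.IsCmp n s t a a c)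
    (hge : ord.gt (σ.app s) (σ.app t) ∨ σ.app s = σ.app t) : D.EvalStep ord σ n a := by
  by_cases hgt : ord.gt (σ.app s) (σ.app t)
  · exact h.evalStep_gt hgt
  · exact h.evalStep_eq hgt (hge.resolve_left hgt)

theorem evalStep_of_not_ge (h : D.IsCmp n s t a b c)
    (hge : ¬ (ord.gt (σ.app s) (σ.app t) ∨ σ.app s = σ.app t)) : D.EvalStep ord σ n c :=
  h.evalStep_ngeq (fun hgt => hge (.inl hgt)) fun heq => hge (.inr heq)

theorem evalStep_of_not_gt (h : D.IsCmp n s t a c c) (hgt : ¬ ord.gt (σ.app s) (σ.app t)) :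
    D.EvalStep ord σ n c := by
  by_cases heq : σ.app s = σ.app t
  · exact h.evalStep_eq hgt heq
  · exact h.evalStep_ngeq hgt heq

theorem adj_gt (h : D.IsCmp n s t a b c) : D.Adj n a :=
  ⟨some .gt, h.1, by simp [h.2.1, NodeLabel.out], h.2.2.1⟩

theorem adj_eq (h : D.IsCmp n s t a b c) : D.Adj n b :=
  ⟨some .eq, h.1, by simp [h.2.1, NodeLabel.out], h.2.2.2.1⟩

theorem adj_ngeq (h : D.IsCmp n s t a b c) : D.Adj n c :=
  ⟨some .ngeq, h.1, by simp [h.2.1, NodeLabel.out], h.2.2.2.2⟩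

end IsCmp

namespace IsPos

variable {prec : Symb L → Symb L → Prop} {hprec : IsStrictTotalOrder (Symb L) prec}
  {wt : Symb L → ℕ}

theorem evalStep (h : D.IsPos n e a b c) {ℓ : EdgeLabel} (hℓ : ord.evalPos σ e = ℓ) :
    D.EvalStep ord σ n (D.next n (some ℓ)) := by
  obtain ⟨hn, hl, -⟩ := h
  refine ⟨hn, hl ▸ trivial, ?_⟩
  rw [hl, TermOrdering.eval, hℓ]

theorem evalStep_gt (h : D.IsPos n (weight wt s - weight wt t) a b c)
    (hpos : LinPos wt (weight wt (σ.app s) - weight wt (σ.app t))) :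
    D.EvalStep (.kbo prec hprec wt) σ n a :=
  h.2.2.1 ▸ h.evalStep (evalPos_weight_sub_eq_gt.2 hpos)

theorem evalStep_geq (h : D.IsPos n (weight wt s - weight wt t) a b c)
    (hpos : ¬ LinPos wt (weight wt (σ.app s) - weight wt (σ.app t)))
    (hnonneg : LinNonneg wt (weight wt (σ.app s) - weight wt (σ.app t))) :
    D.EvalStep (.kbo prec hprec wt) σ n b :=
  h.2.2.2.1 ▸ h.evalStep (evalPos_weight_sub_eq_geq.2 ⟨hpos, hnonneg⟩)

theorem evalStep_ngeq (h : D.IsPos n (weight wt s - weight wt t) a b c)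
    (hnonneg : ¬ LinNonneg wt (weight wt (σ.app s) - weight wt (σ.app t))) :
    D.EvalStep (.kbo prec hprec wt) σ n c :=
  h.2.2.2.2 ▸ h.evalStep (evalPos_weight_sub_eq_ngeq.2 hnonneg)

theorem evalStep_of_nonneg (h : D.IsPos n (weight wt s - weight wt t) a a c)
    (hnonneg : LinNonneg wt (weight wt (σ.app s) - weight wt (σ.app t))) :
    D.EvalStep (.kbo prec hprec wt) σ n a := by
  by_cases hpos : LinPos wt (weight wt (σ.app s) - weight wt (σ.app t))
  · exact h.evalStep_gt hpos
  · exact h.evalStep_geq hpos hnonneg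

theorem evalStep_of_not_pos (h : D.IsPos n (weight wt s - weight wt t) a c c)
    (hpos : ¬ LinPos wt (weight wt (σ.app s) - weight wt (σ.app t))) :
    D.EvalStep (.kbo prec hprec wt) σ n c := by
  by_cases hnonneg : LinNonneg wt (weight wt (σ.app s) - weight wt (σ.app t))
  · exact h.evalStep_geq hpos hnonneg
  · exact h.evalStep_ngeq hnonneg

end IsPos

end Nodes

section RefinesAt

variable {L : FirstOrder.Language.{u, v}} {V : Type w} {ord : TermOrdering L V}
  {D D' : Diagram L V} {ι : Type} {n a b c y : ℕ} {ν d : ι → ℕ} {o : Option ι} {s t : L.Term V}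
  {e : LinExpr V}

theorem leadsDown_nodeAt {k j : ℕ} (f : Fin k → ι) (hy : D.Adj n y)
    (hd : ∀ h : j < k, ∀ i ∈ o, d i < d (f ⟨j, h⟩)) :
    D.LeadsDown n ν d o (nodeAt (ν ∘ f) y j) := by
  rcases le_or_gt k j with hkj | hjk
  · exact .inl (nodeAt_of_ge _ _ hkj ▸ hy)
  · exact .inr ⟨f ⟨j, hjk⟩, dif_pos hjk, hd hjk⟩

theorem IsCmp.refinesAt (h : D'.IsCmp (o.elim n ν) s t a b c) (ha : D.LeadsDown n ν d o a)
    (hb : D.LeadsDown n ν d o b) (hc : D.LeadsDown n ν d o c) : D.RefinesAt ord n ν d D' o where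
  isEval := h.2.1 ▸ trivial
  isKBO_of_pos e he := by simp [h.2.1] at he
  leadsDown ℓ hℓ := by
    obtain ⟨-, hl, hgt, heq, hngeq⟩ := h
    simp only [hl, NodeLabel.out, Set.mem_insert_iff, Set.mem_singleton_iff] at hℓ
    obtain rfl | rfl | rfl := hℓ
    · exact hgt ▸ ha
    · exact heq ▸ hb
    · exact hngeq ▸ hc

theorem IsPos.refinesAt (h : D'.IsPos (o.elim n ν) e a b c) (hord : ord.IsKBO)
    (ha : D.LeadsDown n ν d o a) (hb : D.LeadsDown n ν d o b) (hc : D.LeadsDown n ν d o c) :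
    D.RefinesAt ord n ν d D' o where
  isEval := h.2.1 ▸ trivial
  isKBO_of_pos _ _ := hord
  leadsDown ℓ hℓ := by
    obtain ⟨-, hl, hgt, hgeq, hngeq⟩ := h
    simp only [hl, NodeLabel.out, Set.mem_insert_iff, Set.mem_singleton_iff] at hℓ
    obtain rfl | rfl | rfl := hℓ
    · exact hgt ▸ ha
    · exact hgeq ▸ hb
    · exact hngeq ▸ hc

end RefinesAt

section KBOTransformations

variable {L : FirstOrder.Language.{u, v}} {V : Type w}
  {prec : Symb L → Symb L → Prop} {hprec : IsStrictTotalOrder (Symb L) prec} {wt : Symb L → ℕ}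
  {D D' : Diagram L V} {k m n n₁ n₂ n₃ : ℕ} {f : L.Functions k} {g : L.Functions m}
  {ss ss' : Fin k → L.Term V} {ts : Fin m → L.Term V}

theorem IsCmp.refines_kbo_greater (h : D.IsCmp n (.func f ss) (.func g ts) n₁ n₂ n₃)
    (hfg : prec ⟨k, f⟩ ⟨m, g⟩) (hext : D.Extends n (Fin.elim0 : Fin 0 → ℕ) D')
    (hpos : D'.IsPos n (weight wt (.func f ss) - weight wt (.func g ts)) n₁ n₁ n₃) :
    D.Refines (.kbo prec hprec wt) n Fin.elim0 Fin.elim0 D' where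
  ext := hext
  refinesAt
    | none => hpos.refinesAt trivial (.inl h.adj_gt) (.inl h.adj_gt) (.inl h.adj_ngeq)
    | some i => i.elim0
  exists_evalStep σ := by
    by_cases hnonneg :
        LinNonneg wt (weight wt (σ.app (.func f ss)) - weight wt (σ.app (.func g ts)))
    · exact ⟨n₁, h.evalStep_gt (.prec hnonneg hfg), .single (hpos.evalStep_of_nonneg hnonneg)⟩
    · exact ⟨n₃, h.evalStep_ngeq (mt (KBO.func_iff_of_prec hfg).1 hnonneg)
        (func_ne_func_of_prec hfg), .single (hpos.evalStep_ngeq hnonneg)⟩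

theorem IsCmp.refines_kbo_less (h : D.IsCmp n (.func f ss) (.func g ts) n₁ n₂ n₃)
    (hgf : prec ⟨m, g⟩ ⟨k, f⟩) (hext : D.Extends n (Fin.elim0 : Fin 0 → ℕ) D')
    (hpos : D'.IsPos n (weight wt (.func f ss) - weight wt (.func g ts)) n₁ n₃ n₃) :
    D.Refines (.kbo prec hprec wt) n Fin.elim0 Fin.elim0 D' where
  ext := hext
  refinesAt
    | none => hpos.refinesAt trivial (.inl h.adj_gt) (.inl h.adj_ngeq) (.inl h.adj_ngeq)
    | some i => i.elim0
  exists_evalStep σ := by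
    by_cases hgt : LinPos wt (weight wt (σ.app (.func f ss)) - weight wt (σ.app (.func g ts)))
    · exact ⟨n₁, h.evalStep_gt (.weight_gt hgt), .single (hpos.evalStep_gt hgt)⟩
    · exact ⟨n₃, h.evalStep_ngeq (mt (KBO.func_iff_of_prec_swap hgf).1 hgt)
        (func_ne_func_of_prec hgf).symm, .single (hpos.evalStep_of_not_pos hgt)⟩

theorem IsCmp.exists_evalStep_kbo_same {ν : Fin k → ℕ}
    (h : D.IsCmp n (.func f ss) (.func f ss') n₁ n₂ n₃)
    (hpos : D'.IsPos n (weight wt (.func f ss) - weight wt (.func f ss')) n₁ (nodeAt ν n₂ 0) n₃)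
    (hargs : ∀ i, D'.IsCmp (ν i) (ss i) (ss' i) n₁ (nodeAt ν n₂ (i + 1)) n₃) (σ : Subst L V) :
    ∃ y, D.EvalStep (.kbo prec hprec wt) σ n y ∧
      Relation.ReflTransGen (D'.EvalStep (.kbo prec hprec wt) σ) n y := by
  by_cases hgt : LinPos wt (weight wt (σ.app (.func f ss)) - weight wt (σ.app (.func f ss')))
  · exact ⟨n₁, h.evalStep_gt (.weight_gt hgt), .single (hpos.evalStep_gt hgt)⟩
  by_cases hge : LinNonneg wt (weight wt (σ.app (.func f ss)) - weight wt (σ.app (.func f ss')))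
  swap
  · refine ⟨n₃, h.evalStep_ngeq (fun hf => ?_) fun heq => ?_, .single (hpos.evalStep_ngeq hge)⟩
    · exact (KBO.func_iff_of_same.1 hf).elim hgt fun hf => hge hf.1
    · exact hge (by rw [heq, sub_self]; exact linNonneg_zero)
  have to_args := hpos.evalStep_geq (hprec := hprec) hgt hge
  have gt_iff : KBO prec wt (σ.app (.func f ss)) (σ.app (.func f ss')) ↔
      ∃ i, KBO prec wt (σ.app (ss i)) (σ.app (ss' i)) ∧ ∀ j < i, σ.app (ss j) = σ.app (ss' j) :=
    KBO.func_iff_of_same.trans ((or_iff_right hgt).trans (and_iff_right hge))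
  obtain ⟨hall, hchain⟩ | ⟨j, -, hbefore, hj, hchain⟩ :=
    chain_cases (R := D'.EvalStep (.kbo prec hprec wt) σ) (P := fun i =>
      ¬ KBO prec wt (σ.app (ss i)) (σ.app (ss' i)) ∧ σ.app (ss i) = σ.app (ss' i))
      (fun i hi => (hargs i).evalStep_eq hi.1 hi.2) 0
  · refine ⟨n₂, h.evalStep_eq (fun hf => ?_) ?_, .head to_args hchain⟩
    · obtain ⟨i, hi, -⟩ := gt_iff.1 hf
      exact (hall i i.val.zero_le).1 hi
    · exact congrArg (Term.func f) (funext fun i => (hall i i.val.zero_le).2)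
  by_cases hjgt : KBO prec wt (σ.app (ss j)) (σ.app (ss' j))
  · have hf := gt_iff.2 ⟨j, hjgt, fun i hij => (hbefore i i.val.zero_le hij).2⟩
    exact ⟨n₁, h.evalStep_gt hf, .head to_args (hchain.tail ((hargs j).evalStep_gt hjgt))⟩
  · have hjne : σ.app (ss j) ≠ σ.app (ss' j) := fun heq => hj ⟨hjgt, heq⟩
    refine ⟨n₃, h.evalStep_ngeq (fun hf => ?_) fun heq => ?_,
      .head to_args (hchain.tail ((hargs j).evalStep_ngeq hjgt hjne))⟩
    · obtain ⟨i, hi, heq⟩ := gt_iff.1 hf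
      obtain hij | rfl | hji := lt_trichotomy i j
      · exact (hbefore i i.val.zero_le hij).1 hi
      · exact hjgt hi
      · exact hjne (heq j hji)
    · exact hjne (congrFun (eq_of_heq (Term.func.inj heq).2.2) j)

theorem IsCmp.refines_kbo_same {ν : Fin k → ℕ}
    (h : D.IsCmp n (.func f ss) (.func f ss') n₁ n₂ n₃) (hext : D.Extends n ν D')
    (hpos : D'.IsPos n (weight wt (.func f ss) - weight wt (.func f ss')) n₁ (nodeAt ν n₂ 0) n₃)
    (hargs : ∀ i, D'.IsCmp (ν i) (ss i) (ss' i) n₁ (nodeAt ν n₂ (i + 1)) n₃) :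
    D.Refines (.kbo prec hprec wt) n ν (fun i => i) D' where
  ext := hext
  refinesAt
    | none => hpos.refinesAt trivial (.inl h.adj_gt)
        (leadsDown_nodeAt id h.adj_eq (by simp)) (.inl h.adj_ngeq)
    | some i => (hargs i).refinesAt (.inl h.adj_gt)
        (leadsDown_nodeAt id h.adj_eq (by simp)) (.inl h.adj_ngeq)
  exists_evalStep := h.exists_evalStep_kbo_same hpos hargs

theorem KBOReplace.localChange (h : KBOReplace prec wt D n D')
    (hD : D.IsPreTOD (.kbo prec hprec wt)) :
    LocalChange (.kbo prec hprec wt) D n D' ∧ ∀ x ℓ, D.Edge x ℓ n → D'.Edge x ℓ n := by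
  have of_refines : ∀ {ι : Type} {ν d : ι → ℕ}, D.Refines (.kbo prec hprec wt) n ν d D' →
      LocalChange (.kbo prec hprec wt) D n D' ∧ ∀ x ℓ, D.Edge x ℓ n → D'.Edge x ℓ n :=
    fun h => ⟨h.localChange hD, fun _ _ => h.edge_of_edge_self hD⟩
  cases h with
  | greater h hfg hext hpos => exact of_refines (h.refines_kbo_greater hfg hext hpos)
  | less h hgf hext hpos => exact of_refines (h.refines_kbo_less hgf hext hpos)
  | same ν h hext hpos hargs => exact of_refines (h.refines_kbo_same hext hpos hargs)

end KBOTransformations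

section LPOTransformations

variable {L : FirstOrder.Language.{u, v}} {V : Type w}
  {prec : Symb L → Symb L → Prop} {hprec : IsStrictTotalOrder (Symb L) prec}
  {D D' : Diagram L V} {k m n n₁ n₂ n₃ : ℕ}

theorem IsCmp.refines_lpo_greater {f : L.Functions k} {g : L.Functions (m + 1)}
    {ss : Fin k → L.Term V} {ts : Fin (m + 1) → L.Term V} {ν : Fin m → ℕ}
    (h : D.IsCmp n (.func f ss) (.func g ts) n₁ n₂ n₃) (hfg : prec ⟨k, f⟩ ⟨m + 1, g⟩)
    (hext : D.Extends n ν D')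
    (hargs : ∀ i : Fin (m + 1), D'.IsCmp ((Fin.cons n ν : Fin (m + 1) → ℕ) i)
      (.func f ss) (ts i) (nodeAt ν n₁ i) n₃ n₃) :
    D.Refines (.lpo prec hprec) n ν (fun i => i) D' where
  ext := hext
  refinesAt
    | none => (hargs 0).refinesAt (leadsDown_nodeAt id h.adj_gt (by simp))
        (.inl h.adj_ngeq) (.inl h.adj_ngeq)
    | some i => (hargs i.succ).refinesAt (leadsDown_nodeAt id h.adj_gt (by simp))
        (.inl h.adj_ngeq) (.inl h.adj_ngeq)
  exists_evalStep σ := by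
    have gt_iff : LPO prec (σ.app (.func f ss)) (σ.app (.func g ts)) ↔
        ∀ i, LPO prec (σ.app (.func f ss)) (σ.app (ts i)) := LPO.func_iff_of_prec hfg
    have hpass : ∀ i, LPO prec (σ.app (.func f ss)) (σ.app (ts i)) →
        D'.EvalStep (.lpo prec hprec) σ ((Fin.cons n ν : Fin (m + 1) → ℕ) i)
          (nodeAt (Fin.cons n ν : Fin (m + 1) → ℕ) n₁ (i + 1)) := fun i hi =>
      nodeAt_cons_succ n ν n₁ i ▸ (hargs i).evalStep_gt hi
    have hstart := nodeAt_cons_zero n ν n₁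
    by_cases hgt : ∀ i, LPO prec (σ.app (.func f ss)) (σ.app (ts i))
    · exact ⟨n₁, h.evalStep_gt (gt_iff.2 hgt),
        hstart ▸ chain_of_forall hpass (i := 0) fun i _ => hgt i⟩
    · obtain ⟨i, hi⟩ := not_forall.1 hgt
      exact ⟨n₃, h.evalStep_ngeq (mt gt_iff.1 hgt) (func_ne_func_of_prec hfg),
        hstart ▸ chain_of_exists_not hpass (fun i hi => (hargs i).evalStep_of_not_gt hi)
          ⟨i, i.val.zero_le, hi⟩⟩

theorem IsCmp.refines_lpo_less {f : L.Functions (k + 1)} {g : L.Functions m}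
    {ss : Fin (k + 1) → L.Term V} {ts : Fin m → L.Term V} {ν : Fin k → ℕ}
    (h : D.IsCmp n (.func f ss) (.func g ts) n₁ n₂ n₃) (hgf : prec ⟨m, g⟩ ⟨k + 1, f⟩)
    (hext : D.Extends n ν D')
    (hargs : ∀ i : Fin (k + 1), D'.IsCmp ((Fin.cons n ν : Fin (k + 1) → ℕ) i)
      (ss i) (.func g ts) n₁ n₁ (nodeAt ν n₃ i)) :
    D.Refines (.lpo prec hprec) n ν (fun i => i) D' where
  ext := hext
  refinesAt
    | none => (hargs 0).refinesAt (.inl h.adj_gt) (.inl h.adj_gt)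
        (leadsDown_nodeAt id h.adj_ngeq (by simp))
    | some i => (hargs i.succ).refinesAt (.inl h.adj_gt) (.inl h.adj_gt)
        (leadsDown_nodeAt id h.adj_ngeq (by simp))
  exists_evalStep σ := by
    have gt_iff : LPO prec (σ.app (.func f ss)) (σ.app (.func g ts)) ↔
        ∃ i, LPO prec (σ.app (ss i)) (σ.app (.func g ts)) ∨ σ.app (ss i) = σ.app (.func g ts) :=
      LPO.func_iff_of_prec_swap hgf
    have hpass : ∀ i,
        ¬ (LPO prec (σ.app (ss i)) (σ.app (.func g ts)) ∨ σ.app (ss i) = σ.app (.func g ts)) →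
        D'.EvalStep (.lpo prec hprec) σ ((Fin.cons n ν : Fin (k + 1) → ℕ) i)
          (nodeAt (Fin.cons n ν : Fin (k + 1) → ℕ) n₃ (i + 1)) := fun i hi =>
      nodeAt_cons_succ n ν n₃ i ▸ (hargs i).evalStep_of_not_ge hi
    have hstart := nodeAt_cons_zero n ν n₃
    by_cases hge : ∃ i,
        LPO prec (σ.app (ss i)) (σ.app (.func g ts)) ∨ σ.app (ss i) = σ.app (.func g ts)
    · obtain ⟨i, hi⟩ := hge
      exact ⟨n₁, h.evalStep_gt (gt_iff.2 ⟨i, hi⟩), hstart ▸ chain_of_exists_not hpass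
        (fun i hi => (hargs i).evalStep_of_ge (not_not.1 hi))
        ⟨i, i.val.zero_le, not_not.2 hi⟩⟩
    · exact ⟨n₃, h.evalStep_ngeq (mt gt_iff.1 hge) (func_ne_func_of_prec hgf).symm,
        hstart ▸ chain_of_forall hpass (i := 0) fun i _ => not_exists.1 hge i⟩

section Same

variable {f : L.Functions (k + 1)} {ss ss' : Fin (k + 1) → L.Term V} {left mid right : Fin k → ℕ}

theorem IsCmp.exists_evalStep_lpo_left (h : D.IsCmp n (.func f ss) (.func f ss') n₁ n₂ n₃)
    (hleft : ∀ i : Fin k, D'.IsCmp (left i) (.func f ss) (ss' i.succ)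
      (nodeAt left n₁ (i + 1)) n₃ n₃)
    {σ : Subst L V} {j : Fin (k + 1)} (heq : ∀ i < j, σ.app (ss i) = σ.app (ss' i))
    (hj : LPO prec (σ.app (ss j)) (σ.app (ss' j))) :
    ∃ y, D.EvalStep (.lpo prec hprec) σ n y ∧
      Relation.ReflTransGen (D'.EvalStep (.lpo prec hprec) σ) (nodeAt left n₁ j) y := by
  have gt_iff : LPO prec (σ.app (.func f ss)) (σ.app (.func f ss')) ↔
      ∀ i > j, LPO prec (σ.app (.func f ss)) (σ.app (ss' i)) := LPO.func_iff_of_first_gt heq hj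
  have hpass : ∀ i : Fin k, LPO prec (σ.app (.func f ss)) (σ.app (ss' i.succ)) →
      D'.EvalStep (.lpo prec hprec) σ (left i) (nodeAt left n₁ (i + 1)) := fun i hi =>
    (hleft i).evalStep_gt hi
  by_cases hgt : ∀ i > j, LPO prec (σ.app (.func f ss)) (σ.app (ss' i))
  · exact ⟨n₁, h.evalStep_gt (gt_iff.2 hgt),
      chain_of_forall hpass fun i hji => hgt i.succ (Nat.lt_succ_of_le hji)⟩
  · push Not at hgt
    obtain ⟨i, hji, hi⟩ := hgt
    obtain ⟨i, rfl⟩ := Fin.exists_succ_eq.2 (Fin.ne_zero_of_lt hji)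
    exact ⟨n₃, h.evalStep_ngeq (fun hf => hi (gt_iff.1 hf _ hji))
      (fun hf => hi (LPO.gt_arg_of_ge (.inr hf) i.succ)),
      chain_of_exists_not hpass (fun i hi => (hleft i).evalStep_of_not_gt hi)
        ⟨i, Nat.le_of_lt_succ hji, hi⟩⟩

theorem IsCmp.exists_evalStep_lpo_right (h : D.IsCmp n (.func f ss) (.func f ss') n₁ n₂ n₃)
    (hright : ∀ i : Fin k, D'.IsCmp (right i) (ss i.succ) (.func f ss')
      n₁ n₁ (nodeAt right n₃ (i + 1)))
    {σ : Subst L V} {j : Fin (k + 1)}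
    (heq : ∀ i < j, ¬ LPO prec (σ.app (ss i)) (σ.app (ss' i)) ∧ σ.app (ss i) = σ.app (ss' i))
    (hj : ¬ LPO prec (σ.app (ss j)) (σ.app (ss' j))) (hne : σ.app (ss j) ≠ σ.app (ss' j)) :
    ∃ y, D.EvalStep (.lpo prec hprec) σ n y ∧
      Relation.ReflTransGen (D'.EvalStep (.lpo prec hprec) σ) (nodeAt right n₃ j) y := by
  have gt_iff : LPO prec (σ.app (.func f ss)) (σ.app (.func f ss')) ↔
      ∃ i > j, LPO prec (σ.app (ss i)) (σ.app (.func f ss')) ∨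
        σ.app (ss i) = σ.app (.func f ss') := LPO.func_iff_of_first_not_ge heq hj hne
  have hpass : ∀ i : Fin k, ¬ (LPO prec (σ.app (ss i.succ)) (σ.app (.func f ss')) ∨
      σ.app (ss i.succ) = σ.app (.func f ss')) →
      D'.EvalStep (.lpo prec hprec) σ (right i) (nodeAt right n₃ (i + 1)) := fun i hi =>
    (hright i).evalStep_of_not_ge hi
  by_cases hge : ∃ i > j, LPO prec (σ.app (ss i)) (σ.app (.func f ss')) ∨
      σ.app (ss i) = σ.app (.func f ss')
  · obtain ⟨i, hji, hi⟩ := hge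
    refine ⟨n₁, h.evalStep_gt (gt_iff.2 ⟨i, hji, hi⟩), ?_⟩
    obtain ⟨i, rfl⟩ := Fin.exists_succ_eq.2 (Fin.ne_zero_of_lt hji)
    exact chain_of_exists_not hpass (fun i hi => (hright i).evalStep_of_ge (not_not.1 hi))
      ⟨i, Nat.le_of_lt_succ hji, not_not.2 hi⟩
  · exact ⟨n₃, h.evalStep_ngeq (mt gt_iff.1 hge)
      fun heq => hne (congrFun (eq_of_heq (Term.func.inj heq).2.2) j),
      chain_of_forall hpass fun i hji hi => hge ⟨i.succ, Nat.lt_succ_of_le hji, hi⟩⟩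

theorem IsCmp.exists_evalStep_lpo_same (h : D.IsCmp n (.func f ss) (.func f ss') n₁ n₂ n₃)
    (hmid : ∀ i : Fin (k + 1), D'.IsCmp ((Fin.cons n mid : Fin (k + 1) → ℕ) i)
      (ss i) (ss' i) (nodeAt left n₁ i) (nodeAt mid n₂ i) (nodeAt right n₃ i))
    (hleft : ∀ i : Fin k, D'.IsCmp (left i) (.func f ss) (ss' i.succ)
      (nodeAt left n₁ (i + 1)) n₃ n₃)
    (hright : ∀ i : Fin k, D'.IsCmp (right i) (ss i.succ) (.func f ss')
      n₁ n₁ (nodeAt right n₃ (i + 1)))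
    (σ : Subst L V) :
    ∃ y, D.EvalStep (.lpo prec hprec) σ n y ∧
      Relation.ReflTransGen (D'.EvalStep (.lpo prec hprec) σ) n y := by
  have hchain := chain_cases (R := D'.EvalStep (.lpo prec hprec) σ)
    (μ := (Fin.cons n mid : Fin (k + 1) → ℕ)) (e := n₂) (P := fun i =>
      ¬ LPO prec (σ.app (ss i)) (σ.app (ss' i)) ∧ σ.app (ss i) = σ.app (ss' i))
    (fun i hi => nodeAt_cons_succ n mid n₂ i ▸ (hmid i).evalStep_eq hi.1 hi.2) 0
  rw [nodeAt_cons_zero] at hchain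
  obtain ⟨hall, hchain⟩ | ⟨j, -, hbefore, hj, hchain⟩ := hchain
  · have heq : σ.app (.func f ss) = σ.app (.func f ss') :=
      congrArg (Term.func f) (funext fun i => (hall i i.val.zero_le).2)
    refine ⟨n₂, h.evalStep_eq (fun hf => ?_) heq, hchain⟩
    rw [← heq] at hf
    refine LPO.not_func_self (fun i hi => ?_) hf
    exact (hall i i.val.zero_le).1 ((hall i i.val.zero_le).2 ▸ hi)
  · replace hbefore := fun i => hbefore i i.val.zero_le
    by_cases hgt : LPO prec (σ.app (ss j)) (σ.app (ss' j))
    · obtain ⟨y, hy, hleft⟩ := h.exists_evalStep_lpo_left hleft (fun i hi => (hbefore i hi).2) hgt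
      exact ⟨y, hy, (hchain.tail ((hmid j).evalStep_gt hgt)).trans hleft⟩
    · have hne : σ.app (ss j) ≠ σ.app (ss' j) := fun heq => hj ⟨hgt, heq⟩
      obtain ⟨y, hy, hright⟩ := h.exists_evalStep_lpo_right hright hbefore hgt hne
      exact ⟨y, hy, (hchain.tail ((hmid j).evalStep_ngeq hgt hne)).trans hright⟩

theorem IsCmp.refines_lpo_same (h : D.IsCmp n (.func f ss) (.func f ss') n₁ n₂ n₃)
    (hext : D.Extends n (Sum.elim left (Sum.elim mid right)) D')
    (hmid : ∀ i : Fin (k + 1), D'.IsCmp ((Fin.cons n mid : Fin (k + 1) → ℕ) i)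
      (ss i) (ss' i) (nodeAt left n₁ i) (nodeAt mid n₂ i) (nodeAt right n₃ i))
    (hleft : ∀ i : Fin k, D'.IsCmp (left i) (.func f ss) (ss' i.succ)
      (nodeAt left n₁ (i + 1)) n₃ n₃)
    (hright : ∀ i : Fin k, D'.IsCmp (right i) (ss i.succ) (.func f ss')
      n₁ n₁ (nodeAt right n₃ (i + 1))) :
    D.Refines (.lpo prec hprec) n (Sum.elim left (Sum.elim mid right))
      (Sum.elim (↑) (Sum.elim (↑) (↑))) D' where
  ext := hext
  refinesAt
    | none => (hmid 0).refinesAt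
        (leadsDown_nodeAt Sum.inl h.adj_gt (by simp))
        (leadsDown_nodeAt (Sum.inr ∘ Sum.inl) h.adj_eq (by simp))
        (leadsDown_nodeAt (Sum.inr ∘ Sum.inr) h.adj_ngeq (by simp))
    | some (.inl i) => (hleft i).refinesAt
        (leadsDown_nodeAt Sum.inl h.adj_gt (by simp)) (.inl h.adj_ngeq) (.inl h.adj_ngeq)
    | some (.inr (.inl i)) => (hmid i.succ).refinesAt
        (leadsDown_nodeAt Sum.inl h.adj_gt (by simp))
        (leadsDown_nodeAt (Sum.inr ∘ Sum.inl) h.adj_eq (by simp))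
        (leadsDown_nodeAt (Sum.inr ∘ Sum.inr) h.adj_ngeq (by simp))
    | some (.inr (.inr i)) => (hright i).refinesAt (.inl h.adj_gt) (.inl h.adj_gt)
        (leadsDown_nodeAt (Sum.inr ∘ Sum.inr) h.adj_ngeq (by simp))
  exists_evalStep := h.exists_evalStep_lpo_same hmid hleft hright

end Same

theorem LPOReplace.localChange {top : ℕ} (h : LPOReplace prec D n D' top)
    (hD : D.IsPreTOD (.lpo prec hprec)) :
    LocalChange (.lpo prec hprec) D n D' ∧ ∀ x ℓ, D.Edge x ℓ n → D'.Edge x ℓ top := by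
  have of_refines : ∀ {ι : Type} {ν d : ι → ℕ}, D.Refines (.lpo prec hprec) n ν d D' →
      LocalChange (.lpo prec hprec) D n D' ∧ ∀ x ℓ, D.Edge x ℓ n → D'.Edge x ℓ n :=
    fun h => ⟨h.localChange hD, fun _ _ => h.edge_of_edge_self hD⟩
  have of_replaceNode (hadj : D.Adj n top) (heval : ∀ σ, D.EvalStep (.lpo prec hprec) σ n top) :
      LocalChange (.lpo prec hprec) D n (D.replaceNode n top) ∧
        ∀ x ℓ, D.Edge x ℓ n → (D.replaceNode n top).Edge x ℓ top :=
    ⟨hD.localChange_replaceNode hadj heval, fun _ _ he => he.replaceNode⟩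
  cases h with
  | greater_const h hfg hD' =>
    exact hD' ▸ of_replaceNode h.adj_gt fun σ =>
      h.evalStep_gt ((LPO.func_iff_of_prec hfg).2 (Fin.elim0 ·))
  | greater ν h hfg hext hargs => exact of_refines (h.refines_lpo_greater hfg hext hargs)
  | less_const h hgf hD' =>
    exact hD' ▸ of_replaceNode h.adj_ngeq fun σ => h.evalStep_ngeq
      (fun hf => ((LPO.func_iff_of_prec_swap hgf).1 hf).choose.elim0)
      (func_ne_func_of_prec hgf).symm
  | less ν h hgf hext hargs => exact of_refines (h.refines_lpo_less hgf hext hargs)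
  | @same_const f ss ts _ _ _ h hD' =>
    refine hD' ▸ of_replaceNode h.adj_eq fun σ => ?_
    have heq : σ.app (.func f ss) = σ.app (.func f ts) := by rw [Subsingleton.elim ss ts]
    exact h.evalStep_eq (heq ▸ LPO.not_func_self (Fin.elim0 ·)) heq
  | same left mid right h hext hmid hleft hright =>
    exact of_refines (h.refines_lpo_same hext hmid hleft hright)

end LPOTransformations

section Transformations

variable {L : FirstOrder.Language.{u, v}} {V : Type w} {ord : TermOrdering L V}
  {D D' : Diagram L V} {n top : ℕ}

theorem SpecificTransformation.exists_localChange (h : D.SpecificTransformation ord n D' top)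
    (hD : D.IsPreTOD ord) :
    ∃ D₁, Cleanup D₁ D' ∧ LocalChange ord D n D₁ ∧ ∀ x ℓ, D.Edge x ℓ n → D₁.Edge x ℓ top := by
  cases ord with
  | kbo prec hprec wt =>
    obtain ⟨D₁, h, hclean, rfl⟩ := h
    exact ⟨D₁, hclean, h.localChange hD⟩
  | lpo prec hprec =>
    obtain ⟨D₁, h, hclean⟩ := h
    exact ⟨D₁, hclean, h.localChange hD⟩
  | other gt hgt => exact h.elim

end Transformations

section UniquePaths

variable {L : FirstOrder.Language.{u, v}} {V : Type w} {ord : TermOrdering L V}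
  {D D' : Diagram L V} {S : Finset ℕ}

/-- The nodes in `S` have at most one incoming edge each, and that one comes from a node in `S` or
from the root. In a TOD, such nodes form a tree that hangs off the root. -/
structure UniquePaths (D : Diagram L V) (S : Finset ℕ) : Prop where
  mem : ∀ n ∈ S, n ∈ D.nodes
  ne_exit : ∀ n ∈ S, n ≠ D.exit
  subsingleton : ∀ n ∈ S, (D.inEdges n).Subsingleton
  source : ∀ n ∈ S, ∀ m ℓ, D.Edge m ℓ n → m ∈ S ∨ m = D.root

theorem uniquePaths_empty (D : Diagram L V) : D.UniquePaths ∅ :=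
  ⟨nofun, nofun, nofun, nofun⟩

theorem UniquePaths.path_unique (hS : D.UniquePaths S) (h : D.IsPreTOD ord) {n : ℕ}
    (hn : n ∈ S ∨ n = D.root) {π π' : List (ℕ × Option EdgeLabel)}
    (hπ : D.IsPath D.root π n) (hπ' : D.IsPath D.root π' n) : π = π' := by
  induction π using List.reverseRecOn generalizing n π' with
  | nil =>
    obtain ⟨rfl, -⟩ := isPath_nil_iff.1 hπ
    exact (h.eq_nil_of_isPath_root hπ').symm
  | append_singleton π p ih =>
    obtain ⟨m, ℓ⟩ := p
    obtain ⟨hm, he⟩ := h.isPath_concat_iff.1 hπ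
    have hnr := (h.target _ _ _ he).2
    have hnS := hn.resolve_right hnr
    obtain rfl | ⟨π', ⟨m', ℓ'⟩, rfl⟩ := π'.eq_nil_or_concat'
    · exact absurd (isPath_nil_iff.1 hπ').1.symm hnr
    · obtain ⟨hm', he'⟩ := h.isPath_concat_iff.1 hπ'
      obtain ⟨rfl, rfl⟩ : m = m' ∧ ℓ = ℓ' := Prod.mk.inj (hS.subsingleton n hnS he he')
      rw [ih (hS.source n hnS m ℓ he) hm hm']

theorem IsTOD.exists_isPath (h : D.IsTOD ord) {n : ℕ} (hn : n ∈ D.nodes) :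
    ∃ π, D.IsPath D.root π n := by
  induction h.reachable_root n hn with
  | refl => exact ⟨[], .nil h.root_mem⟩
  | tail _ he ih =>
    obtain ⟨ℓ, he⟩ := he
    obtain ⟨π, hπ⟩ := ih he.1
    exact ⟨_, h.isPreTOD.isPath_concat_iff.2 ⟨hπ, he⟩⟩

theorem UniquePaths.existsUnique_path (hS : D.UniquePaths S) (h : D.IsTOD ord) {n : ℕ}
    (hn : n ∈ S) : ∃! π, D.IsPath D.root π n := by
  obtain ⟨π, hπ⟩ := h.exists_isPath (hS.mem n hn)
  exact ⟨π, hπ, fun π' hπ' => hS.path_unique h.isPreTOD (.inl hn) hπ' hπ⟩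

theorem UniquePaths.of_edge_of_edge (hS : D.UniquePaths S) (hroot : D'.root = D.root)
    (hexit : D'.exit = D.exit) (hsub : D.nodes ⊆ D'.nodes)
    (hedge : ∀ n ∈ S, ∀ m ℓ, D'.Edge m ℓ n → D.Edge m ℓ n) : D'.UniquePaths S where
  mem n hn := hsub (hS.mem n hn)
  ne_exit n hn := hexit ▸ hS.ne_exit n hn
  subsingleton n hn := (hS.subsingleton n hn).anti fun _ he => hedge n hn _ _ he
  source n hn m ℓ he := hroot ▸ hS.source n hn m ℓ (hedge n hn m ℓ he)

theorem UniquePaths.localChange (hS : D.UniquePaths S) {n : ℕ} (hn : n ∉ S) (hnr : n ≠ D.root)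
    (hc : LocalChange ord D n D') : D'.UniquePaths S := by
  refine hS.of_edge_of_edge hc.root_eq hc.exit_eq hc.nodes_sub fun v hv m ℓ he => ?_
  refine hc.edge_of_not_adj m ℓ v (hS.mem v hv) ?_ he
  rintro ⟨k, hnv⟩
  exact (hS.source v hv n k hnv).elim hn hnr

theorem UniquePaths.insert (hS : D.UniquePaths S) {n m : ℕ} {ℓ : Option EdgeLabel}
    (hn : n ∈ D.nodes) (hx : n ≠ D.exit) (hsub : (D.inEdges n).Subsingleton) (he : D.Edge m ℓ n)
    (hm : m ∈ S ∨ m = D.root) : D.UniquePaths (insert n S) where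
  mem := Finset.forall_mem_insert .. |>.2 ⟨hn, hS.mem⟩
  ne_exit := Finset.forall_mem_insert .. |>.2 ⟨hx, hS.ne_exit⟩
  subsingleton := Finset.forall_mem_insert .. |>.2 ⟨hsub, hS.subsingleton⟩
  source := by
    refine Finset.forall_mem_insert .. |>.2 ⟨fun m' ℓ' he' => ?_, fun v hv m' ℓ' he' => ?_⟩
    · obtain ⟨rfl, -⟩ : m = m' ∧ ℓ = ℓ' := Prod.mk.inj (hsub he he')
      exact hm.imp_left Finset.mem_insert_of_mem
    · exact (hS.source v hv m' ℓ' he').imp_left Finset.mem_insert_of_mem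

theorem UniquePaths.trims (hS : D.UniquePaths S) (ht : Trims D D') :
    D'.UniquePaths (S.filter (· ∈ D'.nodes)) where
  mem v hv := (Finset.mem_filter.1 hv).2
  ne_exit v hv := ht.exit_eq ▸ hS.ne_exit v (Finset.mem_filter.1 hv).1
  subsingleton v hv := (hS.subsingleton v (Finset.mem_filter.1 hv).1).anti fun _ he =>
    (ht.edge_iff.1 he).1
  source v hv m ℓ he := by
    rw [ht.root_eq]
    exact (hS.source v (Finset.mem_filter.1 hv).1 m ℓ (ht.edge_iff.1 he).1).imp_left
      fun hm => Finset.mem_filter.2 ⟨hm, he.1⟩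

end UniquePaths

section LocalChange

variable {L : FirstOrder.Language.{u, v}} {V : Type w} {ord : TermOrdering L V}
  {D D₁ D' : Diagram L V} {n : ℕ}

theorem LocalChange.isPath (hc : LocalChange ord D n D') {a b : ℕ}
    {π : List (ℕ × Option EdgeLabel)} (hπ : D.IsPath a π b) (hsource : ∀ p ∈ π, p.1 ≠ n)
    (hb : b ≠ n) : D'.IsPath a π b := by
  induction hπ with
  | nil ha => exact .nil (hc.nodes_sub ha)
  | @cons a c b ℓ π he hcb ih =>
    have hcn : c ≠ n := by
      cases hcb with
      | nil _ => exact hb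
      | cons _ _ => exact hsource _ (.tail _ (.head _))
    exact .cons (hc.edge_of_ne _ _ _ (hsource _ (.head _)) hcn he)
      (ih (fun p hp => hsource p (.tail _ hp)) hb)

theorem LocalChange.equivalent_of_cleanup (hc : LocalChange ord D n D₁) (h : D.IsPreTOD ord)
    (hclean : Cleanup D₁ D') : D.Equivalent ord D' := by
  have ht := hclean.trims
  refine h.equivalent (ht.isPreTOD hc.isPreTOD) fun σ => ?_
  rw [hc.collect_eq, ht.root_eq, ← hc.root_eq, ht.collect_root_eq hc.isPreTOD σ]

end LocalChange

end Diagram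

namespace Config

section Invariant

variable {L : FirstOrder.Language.{u, v}} {V : Type w} {ord : TermOrdering L V}
  {F : Diagram L V → List (ℕ × Option EdgeLabel) → ℕ → Option EdgeLabel} {σ : Subst L V}
  {c c' : Config L V}

/-- The invariant of a retrieval: the visited nodes have unique paths from the root, and the path
that has been followed runs through visited nodes only, except for the root. -/
structure Invariant (ord : TermOrdering L V) (c : Config L V) : Prop where
  isTOD : c.diag.IsTOD ord
  uniquePaths : c.diag.UniquePaths c.visited
  isPath : c.diag.IsPath c.diag.root c.path c.node
  source : ∀ p ∈ c.path, p.1 ∈ c.visited ∨ p.1 = c.diag.root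

/-- The form of the steps that transform the diagram: a local change at the current node and the
removal of unreachable nodes, where the last edge of the followed path leads to the new current
node. -/
def StepLocal (ord : TermOrdering L V) (c c' : Config L V) : Prop :=
  ∃ D D' π m ℓ n, Diagram.LocalChange ord c.diag c.node D ∧ Diagram.Cleanup D D' ∧
    c.path = π ++ [(m, ℓ)] ∧ D.Edge m ℓ n ∧ c' = c.change D' n

namespace Invariant

theorem node_mem (h : c.Invariant ord) : c.node ∈ c.diag.nodes :=
  h.isPath.mem_right

theorem node_ne_root (h : c.Invariant ord) (hu : c.Unvisited) : c.node ≠ c.diag.root :=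
  h.isTOD.isPreTOD.ne_root_of_isEval_or_isSuccess hu.2

theorem node_ne_exit (h : c.Invariant ord) (hu : c.Unvisited) : c.node ≠ c.diag.exit :=
  h.isTOD.isPreTOD.ne_exit_of_isEval_or_isSuccess hu.2

theorem exists_path_eq_concat (h : c.Invariant ord) (hu : c.Unvisited) :
    ∃ π m ℓ, c.path = π ++ [(m, ℓ)] ∧ c.diag.Edge m ℓ c.node := by
  have hpath := h.isPath
  obtain hπ | ⟨π, ⟨m, ℓ⟩, hπ⟩ := c.path.eq_nil_or_concat'
  · rw [hπ] at hpath
    exact absurd (Diagram.isPath_nil_iff.1 hpath).1.symm (h.node_ne_root hu)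
  · rw [hπ] at hpath
    exact ⟨π, m, ℓ, hπ, (h.isTOD.isPreTOD.isPath_concat_iff.1 hpath).2⟩

theorem uniquePaths_insert (h : c.Invariant ord) (hu : c.Unvisited)
    (hsub : (c.diag.inEdges c.node).Subsingleton) :
    c.diag.UniquePaths (insert c.node c.visited) := by
  obtain ⟨π, m, ℓ, hπ, he⟩ := h.exists_path_eq_concat hu
  exact h.uniquePaths.insert h.node_mem (h.node_ne_exit hu) hsub he
    (h.source (m, ℓ) (by simp [hπ]))

theorem source_ne_node (h : c.Invariant ord) (hu : c.Unvisited) {p : ℕ × Option EdgeLabel}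
    (hp : p ∈ c.path) : p.1 ≠ c.node := fun hpn =>
  (h.source p hp).elim (fun hv => hu.1 (hpn ▸ hv)) fun hr => h.node_ne_root hu (hpn ▸ hr)

theorem isPath_localChange (h : c.Invariant ord) (hu : c.Unvisited) {D : Diagram L V}
    (hc : Diagram.LocalChange ord c.diag c.node D) {π : List (ℕ × Option EdgeLabel)} {m n : ℕ}
    {ℓ : Option EdgeLabel} (hπ : c.path = π ++ [(m, ℓ)]) (he : D.Edge m ℓ n) :
    D.IsPath D.root c.path n := by
  have hpath := h.isPath
  rw [hπ, h.isTOD.isPreTOD.isPath_concat_iff] at hpath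
  rw [hc.root_eq, hπ, hc.isPreTOD.isPath_concat_iff]
  exact ⟨hc.isPath hpath.1 (fun p hp => h.source_ne_node hu (by simp [hπ, hp]))
    (h.source_ne_node hu (p := (m, ℓ)) (by simp [hπ])), he⟩

theorem stepLocal (h : c.Invariant ord) (hu : c.Unvisited) (hs : StepLocal ord c c') :
    c'.Invariant ord ∧ c.diag.Equivalent ord c'.diag := by
  obtain ⟨D, D', π, m, ℓ, n, hc, hclean, hπ, he, rfl⟩ := hs
  have ht := hclean.trims
  have hD' := hclean.isTOD hc.isPreTOD
  have hpath : D'.IsPath D'.root c.path n :=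
    ht.isPath hc.isPreTOD (ht.root_eq ▸ h.isPath_localChange hu hc hπ he) hD'.root_mem
  refine ⟨⟨hD', (h.uniquePaths.localChange hu.1 (h.node_ne_root hu) hc).trims ht, hpath,
    fun p hp => ?_⟩, hc.equivalent_of_cleanup h.isTOD.isPreTOD hclean⟩
  obtain ⟨_, _, _, -, -, hedge, -⟩ := hpath.exists_split hp
  exact (h.source p hp).imp (fun hv => Finset.mem_filter.2 ⟨hv, hedge.1⟩)
    fun hr => hr.trans (ht.root_eq.trans hc.root_eq).symm

/- The node has only one path from the root, so that every traversal through the node starts with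
the path for which `F` predicts the edge. -/
theorem forces (hF : IsForcingFunction ord F) (h : c.Invariant ord) (hu : c.Unvisited)
    (hsub : (c.diag.inEdges c.node).Subsingleton) (he : (c.diag.label c.node).IsEval)
    {ℓ : EdgeLabel} (hℓ : F c.diag c.path c.node = some ℓ) : c.diag.Forces ord c.node ℓ := by
  refine ⟨he, fun σ' π' hπ' hmem => ?_⟩
  obtain ⟨⟨n, k⟩, hp, rfl : n = c.node⟩ := hmem
  obtain ⟨π₁, π₂, d, rfl, hπ₁, hedge, -⟩ := hπ'.1.exists_split hp
  obtain rfl : π₁ = c.path := (h.uniquePaths_insert hu hsub).path_unique h.isTOD.isPreTOD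
    (.inl (Finset.mem_insert_self _ _)) hπ₁ h.isPath
  rw [← hπ'.2 _ hp he]
  refine hF _ h.isTOD σ' _ _ _ k ℓ hπ₁ hedge (fun q hq => hπ'.2 q ?_) hℓ
  exact (List.prefix_append_right_inj _ |>.2 (List.prefix_append [_] π₂)).subset hq

theorem follow (h : c.Invariant ord) (hn : c.node ∈ c.visited) {ℓ : Option EdgeLabel} {n : ℕ}
    (he : c.diag.Edge c.node ℓ n) :
    Invariant ord { c with path := c.path ++ [(c.node, ℓ)], node := n } where
  isTOD := h.isTOD
  uniquePaths := h.uniquePaths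
  isPath := h.isTOD.isPreTOD.isPath_concat_iff.2 ⟨h.isPath, he⟩
  source p hp := (List.mem_append.1 hp).elim (h.source p) fun hp =>
    .inl ((List.mem_singleton.1 hp).symm ▸ hn)

end Invariant

theorem StepRemove.redundantNodeRemoval (hF : IsForcingFunction ord F) (h : c.Invariant ord)
    (hs : StepRemove F c c') : ∃ m ℓ' ℓ n₂, F c.diag c.path c.node = some ℓ ∧
      c.diag.RedundantNodeRemoval ord m ℓ' c.node ℓ n₂ c'.diag := by
  obtain ⟨hu, hsub, π, m, ℓ', ℓ, n₂, D', -, hℓ, hb, rfl⟩ := hs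
  exact ⟨m, ℓ', ℓ, n₂, hℓ, h.forces hF hu hsub hb.2.1 hℓ, hb⟩

theorem Step.eq_or_transformation (hF : IsForcingFunction ord F) (h : c.Invariant ord)
    (hs : Step ord F σ c c') : c'.diag = c.diag ∨ c.diag.Transformation ord c'.diag := by
  cases hs with
  | success hs | follow hs =>
    obtain ⟨-, -, rfl⟩ := hs
    exact .inl rfl
  | mark hs =>
    obtain ⟨-, -, -, -, rfl⟩ := hs
    exact .inl rfl
  | replicate hs =>
    obtain ⟨-, -, π, m, ℓ, n₂, D', -, hr, rfl⟩ := hs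
    exact .inr (.replication m ℓ c.node n₂ hr)
  | remove hs =>
    obtain ⟨m, ℓ', ℓ, n₂, -, hr⟩ := hs.redundantNodeRemoval hF h
    exact .inr (.redundant m ℓ' c.node ℓ n₂ hr)
  | transform hs =>
    obtain ⟨-, -, D', top, hr, rfl⟩ := hs
    exact .inr (.specific c.node top hr)

theorem StepReplicate.stepLocal (h : c.Invariant ord) (hs : StepReplicate c c') :
    StepLocal ord c c' := by
  obtain ⟨-, hin, π, m, ℓ, n₂, D', hπ, ⟨he, hx, -, hn₂, hD'⟩, rfl⟩ := hs
  obtain rfl : D' = c.diag.replicate m ℓ c.node n₂ := hD'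
  have hc := h.isTOD.isPreTOD.localChange_replicate he hx hn₂
  have hT := hc.isPreTOD.isTOD (h.isTOD.noOrphan.replicate he hn₂ hin)
  exact ⟨_, _, π, m, ℓ, n₂, hc, hT.cleanup_self, hπ, he.replicate hn₂, rfl⟩

theorem StepRemove.stepLocal (hF : IsForcingFunction ord F) (h : c.Invariant ord)
    (hs : StepRemove F c c') : StepLocal ord c c' := by
  obtain ⟨hu, hsub, π, m, ℓ', ℓ, n₂, D', hπ, hℓ, ⟨he, heval, hn, hclean⟩, rfl⟩ := hs
  have hc := h.isTOD.isPreTOD.localChange_redirect he hn (h.forces hF hu hsub heval hℓ)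
  exact ⟨_, D', π, m, ℓ', n₂, hc, hclean, hπ, he.redirect, rfl⟩

theorem StepTransform.stepLocal (h : c.Invariant ord) (hs : StepTransform ord c c') :
    StepLocal ord c c' := by
  obtain ⟨hu, -, D', top, hr, rfl⟩ := hs
  obtain ⟨D, hclean, hc, htop⟩ := hr.exists_localChange h.isTOD.isPreTOD
  obtain ⟨π, m, ℓ, hπ, he⟩ := h.exists_path_eq_concat hu
  exact ⟨D, D', π, m, ℓ, top, hc, hclean, hπ, htop m ℓ he, rfl⟩

theorem Invariant.step (hF : IsForcingFunction ord F) (h : c.Invariant ord)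
    (hs : Step ord F σ c c') : c'.Invariant ord ∧ c.diag.Equivalent ord c'.diag := by
  have hpre := h.isTOD.isPreTOD
  cases hs with
  | success hs =>
    obtain ⟨hn, hl, rfl⟩ := hs
    refine ⟨h.follow hn ⟨h.node_mem, ?_, rfl⟩, fun _ => rfl⟩
    cases hlabel : c.diag.label c.node <;> rw [hlabel] at hl <;> first | exact hl.elim | rfl
  | follow hs =>
    obtain ⟨hn, hl, rfl⟩ := hs
    have hx := hpre.ne_exit_of_isEval_or_isSuccess (.inl hl)
    exact ⟨h.follow hn (hpre.edge_eval σ h.node_mem hx), fun _ => rfl⟩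
  | mark hs =>
    obtain ⟨hu, hsub, -, -, rfl⟩ := hs
    exact ⟨⟨h.isTOD, h.uniquePaths_insert hu hsub, h.isPath,
      fun p hp => (h.source p hp).imp_left Finset.mem_insert_of_mem⟩, fun _ => rfl⟩
  | replicate hs => exact h.stepLocal hs.1 (hs.stepLocal h)
  | remove hs => exact h.stepLocal hs.1 (hs.stepLocal hF h)
  | transform hs => exact h.stepLocal hs.1 (hs.stepLocal h)

end Invariant

end Config

namespace Diagram

section Insertion

variable {L : FirstOrder.Language.{u, v}} {V : Type w} {ord : TermOrdering L V}
  {D : Diagram L V} {a b x y : ℕ} {k : Option EdgeLabel} {l r : L.Term V}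

/-- The diagram that results from inserting the equality `l ≃ r` with the new comparison node `a`
and the new success node `b`. -/
def insertEquality (D : Diagram L V) (a b : ℕ) (l r : L.Term V) : Diagram L V :=
  { D with
    nodes := insert a (insert b D.nodes)
    label := fun x => if x = a then .cmp l r else if x = b then .success l r else D.label x
    next := fun x y =>
      if x = a then (if y = some .gt then b else D.exit)
      else if x = b then D.exit
      else if D.next x y = D.exit then a
      else D.next x y }

theorem mem_insertEquality_nodes :
    x ∈ (D.insertEquality a b l r).nodes ↔ x = a ∨ x = b ∨ x ∈ D.nodes := by
  simp only [insertEquality, Finset.mem_insert]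

theorem insertEquality_label_cmp : (D.insertEquality a b l r).label a = .cmp l r :=
  if_pos rfl

theorem insertEquality_label_success (hab : a ≠ b) :
    (D.insertEquality a b l r).label b = .success l r :=
  (if_neg hab.symm).trans (if_pos rfl)

theorem insertEquality_label_of_mem (ha : a ∉ D.nodes) (hb : b ∉ D.nodes) (hx : x ∈ D.nodes) :
    (D.insertEquality a b l r).label x = D.label x :=
  (if_neg (ne_of_mem_of_not_mem hx ha)).trans (if_neg (ne_of_mem_of_not_mem hx hb))

theorem insertEquality_next_of_mem (ha : a ∉ D.nodes) (hb : b ∉ D.nodes) (hx : x ∈ D.nodes) :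
    (D.insertEquality a b l r).next x k = if D.next x k = D.exit then a else D.next x k :=
  (if_neg (ne_of_mem_of_not_mem hx ha)).trans (if_neg (ne_of_mem_of_not_mem hx hb))

theorem insertEquality_edge_gt : (D.insertEquality a b l r).Edge a (some .gt) b :=
  ⟨mem_insertEquality_nodes.2 (.inl rfl), insertEquality_label_cmp (D := D) ▸ .inl rfl,
    (if_pos rfl).trans (if_pos rfl)⟩

theorem insertEquality_edge_success (hab : a ≠ b) :
    (D.insertEquality a b l r).Edge b none D.exit :=
  ⟨mem_insertEquality_nodes.2 (.inr (.inl rfl)),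
    insertEquality_label_success (D := D) hab ▸ rfl, (if_neg hab.symm).trans (if_pos rfl)⟩

theorem Edge.insertEquality (he : D.Edge x k y) (ha : a ∉ D.nodes) (hb : b ∉ D.nodes) :
    (D.insertEquality a b l r).Edge x k (if y = D.exit then a else y) := by
  obtain ⟨hx, hk, rfl⟩ := he
  exact ⟨mem_insertEquality_nodes.2 (.inr (.inr hx)),
    (insertEquality_label_of_mem ha hb hx).symm ▸ hk, insertEquality_next_of_mem ha hb hx⟩

theorem Edge.of_insertEquality (he : (D.insertEquality a b l r).Edge x k y) (ha : a ∉ D.nodes)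
    (hb : b ∉ D.nodes) (hab : a ≠ b) :
    (x = a ∧ (y = b ∨ y = D.exit)) ∨ (x = b ∧ y = D.exit) ∨
      (y = a ∧ D.Edge x k D.exit) ∨ (y ≠ D.exit ∧ D.Edge x k y) := by
  obtain ⟨hx, hk, rfl⟩ := he
  obtain rfl | rfl | hx := mem_insertEquality_nodes.1 hx
  · refine .inl ⟨rfl, ?_⟩
    by_cases hgt : k = some .gt
    · exact .inl ((if_pos rfl).trans (if_pos hgt))
    · exact .inr ((if_pos rfl).trans (if_neg hgt))
  · exact .inr (.inl ⟨rfl, (if_neg hab.symm).trans (if_pos rfl)⟩)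
  · rw [insertEquality_label_of_mem ha hb hx] at hk
    rw [insertEquality_next_of_mem ha hb hx]
    by_cases hexit : D.next x k = D.exit
    · exact .inr (.inr (.inl ⟨if_pos hexit, hx, hk, hexit⟩))
    · rw [if_neg hexit]
      exact .inr (.inr (.inr ⟨hexit, hx, hk, rfl⟩))

theorem IsPreTOD.acyclic_insertEquality (h : D.IsPreTOD ord) (ha : a ∉ D.nodes)
    (hb : b ∉ D.nodes) (hab : a ≠ b) (n : ℕ) :
    ¬ Relation.TransGen (D.insertEquality a b l r).Adj n n := by
  obtain ⟨ρ, hρ⟩ := h.exists_rank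
  have hne : ∀ x ∈ D.nodes, x ≠ a ∧ x ≠ b := fun x hx =>
    ⟨ne_of_mem_of_not_mem hx ha, ne_of_mem_of_not_mem hx hb⟩
  have hexit := hne _ h.exit_mem
  refine acyclic_of_rank
    (fun x => if x = a then 2 else if x = b then 1 else if x = D.exit then 0 else ρ x + 3) ?_ n
  rintro x y ⟨k, he⟩
  obtain ⟨rfl, rfl | rfl⟩ | ⟨rfl, rfl⟩ | ⟨rfl, he'⟩ | ⟨hy, he'⟩ :=
    he.of_insertEquality ha hb hab
  · simp [hab.symm]
  · simp [hexit]
  · simp [hexit, hab.symm]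
  · simp [hne _ he'.1, h.ne_exit_of_edge he']
  · simpa [hne _ he'.1, hne _ (h.target _ _ _ he').1, hy, h.ne_exit_of_edge he']
      using hρ _ _ ⟨k, he'⟩

theorem IsPreTOD.isPreTOD_insertEquality (h : D.IsPreTOD ord) (ha : a ∉ D.nodes)
    (hb : b ∉ D.nodes) (hab : a ≠ b) : (D.insertEquality a b l r).IsPreTOD ord := by
  have label : ∀ {x}, x ∈ D.nodes → (D.insertEquality a b l r).label x = D.label x := fun hx =>
    insertEquality_label_of_mem ha hb hx
  refine ⟨mem_insertEquality_nodes.2 (.inr (.inr h.root_mem)), (label h.root_mem).trans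
    h.label_root, (label h.exit_mem).trans h.label_exit, fun x hx hxr hxe => ?_,
    fun x k y he => ?_, h.acyclic_insertEquality ha hb hab⟩
  · obtain rfl | rfl | hx := mem_insertEquality_nodes.1 hx
    · rw [insertEquality_label_cmp]
      exact ⟨nofun, nofun, nofun⟩
    · rw [insertEquality_label_success hab]
      exact ⟨nofun, nofun, nofun⟩
    · rw [label hx]
      exact h.isInner_label x hx hxr hxe
  · have hexit : D.exit ∈ (D.insertEquality a b l r).nodes ∧ D.exit ≠ D.root :=
      ⟨mem_insertEquality_nodes.2 (.inr (.inr h.exit_mem)), h.root_ne_exit.symm⟩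
    obtain ⟨-, rfl | rfl⟩ | ⟨-, rfl⟩ | ⟨rfl, -⟩ | ⟨-, he⟩ := he.of_insertEquality ha hb hab
    · exact ⟨mem_insertEquality_nodes.2 (.inr (.inl rfl)),
        (ne_of_mem_of_not_mem h.root_mem hb).symm⟩
    · exact hexit
    · exact hexit
    · exact ⟨mem_insertEquality_nodes.2 (.inl rfl), (ne_of_mem_of_not_mem h.root_mem ha).symm⟩
    · obtain ⟨hy, hyr⟩ := h.target _ _ _ he
      exact ⟨mem_insertEquality_nodes.2 (.inr (.inr hy)), hyr⟩

theorem NoOrphan.insertEquality (ho : D.NoOrphan) (ha : a ∉ D.nodes) (hb : b ∉ D.nodes)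
    (hab : a ≠ b) (hexit : D.exit ∈ D.nodes) (hne : D.exit ≠ D.root) :
    (D.insertEquality a b l r).NoOrphan := by
  intro x hx hxr
  obtain rfl | rfl | hx := mem_insertEquality_nodes.1 hx
  · obtain ⟨⟨m, k⟩, he⟩ := ho _ hexit hne
    have he' := Edge.insertEquality (l := l) (r := r) he ha hb
    rw [if_pos rfl] at he'
    exact ⟨(m, k), he'⟩
  · exact ⟨(a, some .gt), insertEquality_edge_gt⟩
  · by_cases hxe : x = D.exit
    · exact ⟨(b, none), hxe ▸ insertEquality_edge_success hab⟩
    · obtain ⟨⟨m, k⟩, he⟩ := ho x hx hxr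
      have he' := Edge.insertEquality (l := l) (r := r) he ha hb
      rw [if_neg hxe] at he'
      exact ⟨(m, k), he'⟩

theorem IsTOD.insertEquality (h : D.IsTOD ord) (ha : a ∉ D.nodes) (hb : b ∉ D.nodes)
    (hab : a ≠ b) : (D.insertEquality a b l r).IsTOD ord :=
  (h.isPreTOD.isPreTOD_insertEquality ha hb hab).isTOD
    (h.noOrphan.insertEquality ha hb hab h.exit_mem h.isPreTOD.root_ne_exit.symm)

theorem UniquePaths.insertEquality {S : Finset ℕ} (hS : D.UniquePaths S) (ha : a ∉ D.nodes)
    (hb : b ∉ D.nodes) (hab : a ≠ b) : (D.insertEquality a b l r).UniquePaths S := by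
  refine hS.of_edge_of_edge rfl rfl
    (fun x hx => mem_insertEquality_nodes.2 (.inr (.inr hx))) fun n hn m k he => ?_
  have hn' := hS.mem n hn
  obtain ⟨-, rfl | rfl⟩ | ⟨-, rfl⟩ | ⟨rfl, -⟩ | ⟨-, he⟩ := he.of_insertEquality ha hb hab
  · exact absurd hn' hb
  · exact absurd rfl (hS.ne_exit _ hn)
  · exact absurd rfl (hS.ne_exit _ hn)
  · exact absurd hn' ha
  · exact he

end Insertion

end Diagram

namespace Index

section Invariant

variable {L : FirstOrder.Language.{u, v}} {V : Type w} {ord : TermOrdering L V}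
  {F : Diagram L V → List (ℕ × Option EdgeLabel) → ℕ → Option EdgeLabel} {σ : Subst L V}
  {I I' : Index L V}

/-- The invariant of an index between retrievals and insertions. -/
structure Invariant (ord : TermOrdering L V) (I : Index L V) : Prop where
  isTOD : I.diag.IsTOD ord
  uniquePaths : I.diag.UniquePaths I.visited

namespace Invariant

theorem start (h : I.Invariant ord) : I.start.Invariant ord where
  isTOD := h.isTOD
  uniquePaths := h.uniquePaths
  isPath := by
    have he : I.diag.Edge I.diag.root none (I.diag.next I.diag.root none) :=
      ⟨h.isTOD.root_mem, by rw [h.isTOD.isPreTOD.label_root]; rfl, rfl⟩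
    exact .cons he (.nil (h.isTOD.target_mem _ _ _ he))
  source p hp := .inr (List.mem_singleton.1 hp ▸ rfl)

theorem reaches (hF : IsForcingFunction ord F) (h : I.Invariant ord) {c : Config L V}
    (hc : Reaches ord F σ I c) : c.Invariant ord ∧ I.diag.Equivalent ord c.diag := by
  induction hc with
  | refl => exact ⟨h.start, fun _ => rfl⟩
  | tail _ hs ih =>
    obtain ⟨hinv, hequiv⟩ := ih
    obtain ⟨hinv', hequiv'⟩ := hinv.step hF hs
    exact ⟨hinv', fun τ => (hequiv τ).trans (hequiv' τ)⟩

theorem retrieval (hF : IsForcingFunction ord F) (h : I.Invariant ord)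
    (hr : Retrieval ord F σ I I') : I'.Invariant ord ∧ I.diag.Equivalent ord I'.diag := by
  obtain ⟨c, hc, -, rfl⟩ := hr
  obtain ⟨hinv, hequiv⟩ := h.reaches hF hc
  exact ⟨⟨hinv.isTOD, hinv.uniquePaths⟩, hequiv⟩

theorem insertion (h : I.Invariant ord) {l r : L.Term V} (hi : Insertion l r I I') :
    I'.Invariant ord := by
  obtain ⟨a, b, ha, hb, hab, rfl⟩ := hi
  exact ⟨h.isTOD.insertEquality ha hb hab, h.uniquePaths.insertEquality ha hb hab⟩

end Invariant

theorem Arises.invariant (hF : IsForcingFunction ord F) (h : Arises ord F I) :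
    I.Invariant ord := by
  induction h with
  | init D hD => exact ⟨hD, D.uniquePaths_empty⟩
  | insertion l r _ hi ih => exact ih.insertion hi
  | retrieval σ _ hr ih => exact (ih.retrieval hF hr).1

end Invariant

end Index

end TOD

theorem mainTheorem3 {L : FirstOrder.Language.{u, v}} {V : Type w} (ord : TOD.TermOrdering L V)
    (F : TOD.Diagram L V → List (ℕ × Option TOD.EdgeLabel) → ℕ → Option TOD.EdgeLabel)
    (hF : TOD.IsForcingFunction ord F)
    (I : TOD.Index L V) (hI : TOD.Index.Arises ord F I) (σ : TOD.Subst L V) :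
    -- the TOD produced by a retrieval is equivalent to the one before the retrieval
    (∀ I' : TOD.Index L V, TOD.Index.Retrieval ord F σ I I' →
      I'.diag.IsTOD ord ∧ I.diag.Equivalent ord I'.diag) ∧
    -- moreover, at every point of the retrieval:
    (∀ c : TOD.Config L V, TOD.Index.Reaches ord F σ I c →
      c.diag.IsTOD ord ∧ I.diag.Equivalent ord c.diag ∧
      -- a visited node has a unique root path
      (∀ n ∈ c.visited, ∃! π, c.diag.IsPath c.diag.root π n) ∧
      -- a step applied because `F` gives a label is a redundant node removal at the current node
      (∀ c' : TOD.Config L V, TOD.Config.StepRemove F c c' →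
        ∃ m ℓ' ℓ n₂, F c.diag c.path c.node = some ℓ ∧
          c.diag.RedundantNodeRemoval ord m ℓ' c.node ℓ n₂ c'.diag) ∧
      -- every step leaves the TOD unchanged or is a TOD transformation
      (∀ c' : TOD.Config L V, TOD.Config.Step ord F σ c c' →
        c'.diag = c.diag ∨ c.diag.Transformation ord c'.diag)) := by
  have hI' := hI.invariant hF
  refine ⟨fun I' hr => ?_, fun c hc => ?_⟩
  · obtain ⟨hinv, hequiv⟩ := hI'.retrieval hF hr
    exact ⟨hinv.isTOD, hequiv⟩
  · obtain ⟨hinv, hequiv⟩ := hI'.reaches hF hc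
    exact ⟨hinv.isTOD, hequiv, fun n hn => hinv.uniquePaths.existsUnique_path hinv.isTOD hn,
      fun c' hs => hs.redundantNodeRemoval hF hinv, fun c' hs => hs.eq_or_transformation hF hinv⟩
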